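/- For $0<\alpha\le 2$, $|\theta|\le\min\{\alpha,2-\alpha\}$, $0<\beta\le 1$, the fundamental solution $K^\theta_{\alpha,\beta}(\cdot\,;t)$, $t\ge 0$, of the space-time fractional diffusion equation $${}_tD_*^\beta u(x;t)={}_xD_\theta^\alpha u(x;t),\quad x\in\mathbb R,\qquad u(x;0)=\delta(x),\quad u(\pm\infty;t)=0,$$ is the weakly continuous family of finite nonnegative measures $K^\theta_{\alpha,\beta}(dx;t)$ on $\mathbb R$ (written $K^\theta_{\alpha,\beta}(x;t)\,dx$, a Dirac mass being allowed) with $K^\theta_{\alpha,\beta}(dx;0)=\delta_0$ that solves the equation after the Fourier transform $\widehat u(\kappa;t)=\int e^{i\kappa x}u(dx;t)$. Here the Riesz--Feller derivative ${}_xD^\alpha_\theta$ is the Fourier multiplier $-|\kappa|^\alpha e^{i(\operatorname{sign}\kappa)\theta\pi/2}$, and the Caputo derivative ${}_tD_*^\beta$ is given by its Laplace transform, $\int_0^\infty e^{-st}\,{}_tD_*^\beta f(t)\,dt=s^\beta\widetilde f(s)-s^{\beta-1}f(0^+)$ for $s>0$, where $\widetilde f(s)=\int_0^\infty e^{-st}f(t)\,dt$.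 Let $$\mathcal G(x;\xi)=\frac{e^{-x^2/(4\xi)}}{\sqrt{4\pi\xi}},\qquad \xi>0 .$$ **Corollary.** Let $0<\alpha\le 2$ and $0<\beta\le 1$. The fundamental solutions $K^0_{\alpha,\beta}$ and $K^{-\alpha/2}_{\alpha/2,\beta}$ exist and are unique. For every $t>0$ the measure $K^0_{\alpha,\beta}(\cdot\,;t)$ is a probability measure with a density $K^0_{\alpha,\beta}(x;t)$ that is continuous in $x\in\mathbb R$ with values in $[0,\infty]$, finite for $x\ne 0$, and tends to $0$ as $x\to\pm\infty$; this density is the Gaussian mixture $$K^0_{\alpha,\beta}(x;t)=\int_{(0,\infty)}\mathcal G(x;\xi)\,K^{-\alpha/2}_{\alpha/2,\beta}(d\xi;t),\qquad x\in\mathbb R .$$ In particular, whenever $K^{-\alpha/2}_{\alpha/2,\beta}(\cdot\,;t)$ has a density $K^{-\alpha/2}_{\alpha/2,\beta}(\xi;t)$, $$K^0_{\alpha,\beta}(x;t)=\int_0^\infty \mathcal G(x;\xi)\,K^{-\alpha/2}_{\alpha/2,\beta}(\xi;t)\,d\xi .$$ -/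

import Mathlib

open MeasureTheory Filter Topology Set
open scoped NNReal ENNReal

noncomputable section

/-- The Laplace transform `∫₀^∞ e^{-s t} f(t) dt` of a function on `[0, ∞)`, at a real `s`. -/
def laplaceTransform (f : ℝ≥0 → ℂ) (s : ℝ) : ℂ :=
  ∫ t in Ioi (0 : ℝ), (Real.exp (-(s * t)) : ℂ) * f t.toNNReal

/-- `e^{-s t} f(t)` is integrable on `(0, ∞)` for every `s > 0`. -/
def LaplaceTransformable (f : ℝ≥0 → ℂ) : Prop :=
  ∀ s : ℝ, 0 < s →
    IntegrableOn (fun t : ℝ => (Real.exp (-(s * t)) : ℂ) * f t.toNNReal) (Ioi 0)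

/-- `g` is the Caputo derivative of order `0 < β ≤ 1` of `f`, the Caputo derivative being defined
through its Laplace transform:
`∫₀^∞ e^{-s t} g(t) dt = s ^ β * ∫₀^∞ e^{-s t} f(t) dt - s ^ (β - 1) * f(0⁺)` for `s > 0`. -/
def HasCaputoDeriv (β : ℝ) (f g : ℝ≥0 → ℂ) : Prop :=
  LaplaceTransformable f ∧ LaplaceTransformable g ∧
    ∃ f₀ : ℂ, Tendsto f (𝓝[>] 0) (𝓝 f₀) ∧
      ∀ s : ℝ, 0 < s →
        laplaceTransform g s
          = ((s ^ β : ℝ) : ℂ) * laplaceTransform f s - ((s ^ (β - 1) : ℝ) : ℂ) * f₀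

/-- The Fourier symbol `-|κ|^α e^{i (sign κ) θ π / 2}` of the Riesz-Feller derivative of order `α`
and asymmetry `θ`, with respect to the Fourier transform `û(κ) = ∫ e^{i κ x} u(x) dx`. -/
def rieszFellerSymbol (α θ κ : ℝ) : ℂ :=
  -(((|κ| ^ α : ℝ) : ℂ) * Complex.exp (Complex.I * ((SignType.sign κ : ℝ) * θ * Real.pi / 2 : ℝ)))

/-- `K` is a fundamental solution of the space-time fractional diffusion equation
`D_t^β u = D_x^{α,θ} u`, where `D_t^β` is the Caputo derivative and `D_x^{α,θ}` is the Riesz-Feller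
derivative. `K t` is the distribution `K(x; t) dx` on the real line: a (nonnegative) finite measure,
so that a Dirac mass is allowed and no mass sits at `x = ±∞`.
The Fourier transform `∫ e^{i κ x} K(dx; t)` is `MeasureTheory.charFun (K t) κ`; the
space derivative acts on it as multiplication by the symbol. -/
structure IsFundamentalSolution (α θ β : ℝ) (K : ℝ≥0 → FiniteMeasure ℝ) : Prop where
  /-- weak continuity in time, up to time zero -/
  continuous : Continuous K
  /-- the initial condition `u(x; 0) = δ(x)` -/
  initial : (K 0 : Measure ℝ) = Measure.dirac 0
  /-- the equation, after the Fourier transform in space -/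
  equation : ∀ κ : ℝ,
    HasCaputoDeriv β (fun t => charFun (K t : Measure ℝ) κ)
      (fun t => rieszFellerSymbol α θ κ * charFun (K t : Measure ℝ) κ)

/-- The Gaussian heat kernel `e^{-x² / (4 ξ)} / √(4 π ξ)`, for `ξ > 0`. -/
def heatKernel (x ξ : ℝ) : ℝ :=
  Real.exp (-x ^ 2 / (4 * ξ)) / Real.sqrt (4 * Real.pi * ξ)

/-- `p` is the continuous probability density of `μ`: it is continuous with values in `[0, ∞]`,
finite away from `x = 0` (where the densities considered here can have a pole), it vanishes at
`±∞`, and `μ(dx) = p(x) dx`. Continuity makes such a `p` unique at every point. -/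
structure IsContinuousDensity (μ : Measure ℝ) (p : ℝ → ℝ≥0∞) : Prop where
  continuous : Continuous p
  finite : ∀ x, x ≠ 0 → p x < ∞
  vanishing : Tendsto p (cocompact ℝ) (𝓝 0)
  integral_eq_one : ∫⁻ x, p x = 1
  eq_withDensity : μ = volume.withDensity p

end

/-! Subordination. Put `γ = α / 2`, and let `X` and `Y` be independent positive stable variables
with Laplace transforms `exp (-s ^ γ)` and `exp (-s ^ β)`. For `Re ψ ≤ 0` the average over `Y` of
`exp (ψ (t / Y) ^ β)` is the Mittag-Leffler function of `ψ t ^ β`, the Caputo eigenfunction with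
eigenvalue `ψ` and initial value 1 (`hasCaputoDeriv_mittagLeffler`). It is the only continuous one,
because the equation determines its Laplace transform (`HasCaputoDeriv.eq_of_eigen`).

A family of laws with this Fourier transform, `ψ` being the Riesz-Feller symbol, is therefore the
fundamental solution. For index `γ` and asymmetry `-γ`, scaling of the stable law shows that `(t /
Y) ^ (β / γ) * X` has it (`charFun_subordinatedLaw`). If `ξ` denotes this variable and `N` is an
independent standard Gaussian, then `√(2 ξ) N` has Fourier transform `E exp (-κ² ξ)`; since `(κ²) ^
γ = |κ| ^ α`, this is the Fourier transform required for index `α` and asymmetry 0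
(`charFun_gaussianMixture_subordinatedLaw`). So the symmetric solution is a Gaussian mixture over
the one-sided one.

The regularity of the density uses only that `ξ > 0` almost surely for `t > 0`, together with the
bound `1 / |x|` on the heat kernel, uniform in `ξ` (`heatKernel_le_inv_abs`). -/

/-! ### One-sided stable laws. -/

/-- `φ` is the Laplace transform, on `(0, ∞)`, of a probability measure on `[0, ∞]`, written in
the variable `x = e^{-y} ∈ [0, 1]`. -/
def IsLaplaceOfProb (φ : ℝ → ℝ) : Prop :=
  ∃ μ : Measure unitInterval, IsProbabilityMeasure μ ∧
    ∀ s : ℝ, 0 < s → ∫ x, (x : ℝ) ^ s ∂μ = φ s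

namespace IsLaplaceOfProb

lemma one : IsLaplaceOfProb (fun _ => 1) :=
  ⟨Measure.dirac 1, inferInstance, fun s _ => by simp⟩

/-- Adding independent variables `y` multiplies the variables `x = e^{-y}`. -/
lemma mul {φ ψ : ℝ → ℝ} (hφ : IsLaplaceOfProb φ) (hψ : IsLaplaceOfProb ψ) :
    IsLaplaceOfProb (fun s => φ s * ψ s) := by
  obtain ⟨μ, _, hμ⟩ := hφ
  obtain ⟨ν, _, hν⟩ := hψ
  have hm : Measurable (fun p : unitInterval × unitInterval => p.1 * p.2) :=
    (continuous_fst.mul continuous_snd).measurable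
  refine ⟨(μ.prod ν).map (fun p => p.1 * p.2),
    Measure.isProbabilityMeasure_map hm.aemeasurable, fun s hs => ?_⟩
  simp only [← hμ s hs, ← hν s hs]
  rw [← integral_prod_mul, integral_map hm.aemeasurable
    (Continuous.aestronglyMeasurable
      (continuous_subtype_val.rpow_const fun _ => Or.inr hs.le))]
  refine integral_congr_ae (ae_of_all _ fun p => ?_)
  simp only [Set.Icc.coe_mul]
  exact Real.mul_rpow p.1.2.1 p.2.2.1

lemma pow {φ : ℝ → ℝ} (hφ : IsLaplaceOfProb φ) (n : ℕ) :
    IsLaplaceOfProb (fun s => φ s ^ n) := by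
  induction n with
  | zero => simpa using one
  | succ n ih => simpa only [pow_succ] using ih.mul hφ

/-- Probability measures on the compact interval form a compact space, and `x ^ s` is continuous
there for `s > 0`. No tightness is needed: mass escaping to `y = ∞` is kept at `x = 0`. -/
lemma of_tendsto {φ : ℕ → ℝ → ℝ} {ψ : ℝ → ℝ} (hφ : ∀ n, IsLaplaceOfProb (φ n))
    (h : ∀ s, 0 < s → Tendsto (fun n => φ n s) atTop (𝓝 (ψ s))) : IsLaplaceOfProb ψ := by
  choose μ hμp hμ using hφ
  let μ' : ℕ → ProbabilityMeasure unitInterval := fun n => ⟨μ n, hμp n⟩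
  let U : Ultrafilter ℕ := Ultrafilter.of atTop
  have hU : (U : Filter ℕ) ≤ atTop := Ultrafilter.of_le _
  obtain ⟨ν, -, hν⟩ := (isCompact_univ (X := ProbabilityMeasure unitInterval)).ultrafilter_le_nhds
    (U.map μ') (by simp)
  refine ⟨ν, inferInstance, fun s hs => ?_⟩
  have hν' : Tendsto μ' U (𝓝 ν) := hν
  have hc : Continuous (fun x : unitInterval => (x : ℝ) ^ s) :=
    continuous_subtype_val.rpow_const fun _ => Or.inr hs.le
  have h1 := ProbabilityMeasure.tendsto_iff_forall_integral_tendsto.1 hν'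
    (BoundedContinuousFunction.mkOfCompact ⟨_, hc⟩)
  exact tendsto_nhds_unique h1 (((h s hs).mono_left hU).congr fun n => (hμ n s hs).symm)

/-- The transform of the mixture, with density `p y ^ (p - 1) / Y ^ p` on `(0, Y]`, of the
exponential laws of rate `y`. -/
lemma one_sub_integral_rpowIntegrand {Y p : ℝ} (hp : p ∈ Ioo (0 : ℝ) 1) (hY : 0 < Y) :
    IsLaplaceOfProb (fun s => 1 - p / Y ^ p * ∫ y in Ioc 0 Y, Real.rpowIntegrand₀₁ p y s) := by
  have hYp : 0 < Y ^ p := Real.rpow_pos_of_pos hY p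
  let w : ℝ → ℝ := fun y => p / Y ^ p * y ^ (p - 1)
  have hwint : IntegrableOn w (Ioc 0 Y) := by
    refine Integrable.const_mul ?_ _
    have := intervalIntegral.intervalIntegrable_rpow' (a := 0) (b := Y) (r := p - 1)
      (by linarith [hp.1])
    rwa [intervalIntegrable_iff_integrableOn_Ioc_of_le hY.le] at this
  have hw0 : ∀ y ∈ Ioc 0 Y, 0 ≤ w y := fun y hy => by
    have := hp.1; have := hy.1; positivity
  have hw1 : ∫ y in Ioc 0 Y, w y = 1 := by
    simp only [w]
    rw [integral_const_mul, ← intervalIntegral.integral_of_le hY.le,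
      integral_rpow (Or.inl (by linarith [hp.1]))]
    have := hp.1.ne'
    simp [Real.zero_rpow this]
    field_simp
  have hwm : Measurable w := by fun_prop
  let ρ : Measure ℝ := (volume.restrict (Ioc 0 Y)).withDensity (fun y => ENNReal.ofReal (w y))
  have hρ : IsProbabilityMeasure ρ := ⟨by
    rw [withDensity_apply _ MeasurableSet.univ, Measure.restrict_univ,
      ← ofReal_integral_eq_lintegral_ofReal hwint
        (ae_restrict_of_forall_mem measurableSet_Ioc hw0), hw1, ENNReal.ofReal_one]⟩
  let U : Measure ℝ := volume.restrict (Ioc 0 1)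
  have hU : IsProbabilityMeasure U := ⟨by simp [U]⟩
  -- For `v` uniform on `(0, 1]`, `-log (v ^ (1 / y))` is exponential of rate `y`, with transform `y
  -- / (y + s)`.
  let u : ℝ × ℝ → unitInterval := fun q => projIcc 0 1 zero_le_one (q.2 ^ (1 / q.1))
  have hu : Measurable u := continuous_projIcc.measurable.comp (by fun_prop)
  refine ⟨(ρ.prod U).map u, Measure.isProbabilityMeasure_map hu.aemeasurable, fun s hs => ?_⟩
  have hcont : Continuous (fun x : unitInterval => (x : ℝ) ^ s) :=
    continuous_subtype_val.rpow_const fun _ => Or.inr hs.le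
  rw [integral_map hu.aemeasurable hcont.aestronglyMeasurable, integral_prod]
  swap
  · refine Integrable.of_bound (hcont.measurable.comp hu).aestronglyMeasurable 1
      (ae_of_all _ fun q => ?_)
    rw [Real.norm_of_nonneg (Real.rpow_nonneg (u q).2.1 _)]
    exact Real.rpow_le_one (u q).2.1 (u q).2.2 hs.le
  have hin : ∀ y ∈ Ioc 0 Y, ∫ v, ((u (y, v) : unitInterval) : ℝ) ^ s ∂U = y / (y + s) := by
    intro y hy
    have hy0 := hy.1
    have : ∫ v, ((u (y, v) : unitInterval) : ℝ) ^ s ∂U = ∫ v in Ioc (0 : ℝ) 1, v ^ (s / y) := by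
      refine setIntegral_congr_fun measurableSet_Ioc fun v hv => ?_
      have h1 : v ^ (1 / y) ∈ Icc (0 : ℝ) 1 := ⟨Real.rpow_nonneg hv.1.le _,
        Real.rpow_le_one hv.1.le hv.2 (by positivity)⟩
      simp only [u, projIcc_of_mem _ h1]
      rw [← Real.rpow_mul hv.1.le]
      congr 1
      ring
    have h0 : s / y + 1 ≠ 0 := by positivity
    rw [this, ← intervalIntegral.integral_of_le zero_le_one,
      integral_rpow (Or.inl (by have : 0 < s / y := by positivity
                                linarith))]
    simp [Real.zero_rpow h0]
    field_simp
    ring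
  have hint : IntegrableOn (fun y => p / Y ^ p * Real.rpowIntegrand₀₁ p y s) (Ioc 0 Y) :=
    ((Real.integrableOn_rpowIntegrand₀₁_Ioi hp hs.le).mono_set Ioc_subset_Ioi_self).const_mul _
  rw [integral_withDensity_eq_integral_toReal_smul (by fun_prop) (by simp)]
  simp only
  rw [← integral_const_mul, ← hw1, ← integral_sub hwint hint]
  refine setIntegral_congr_fun measurableSet_Ioc fun y hy => ?_
  simp only [hin y hy, ENNReal.toReal_ofReal (hw0 y hy), smul_eq_mul, w]
  rw [Real.rpowIntegrand₀₁_eq_pow_div hp hy.1.le hs.le]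
  have : y + s ≠ 0 := by have := hy.1; positivity
  field_simp
  ring

/-- `s ^ p` is, up to a constant, the integral of `rpowIntegrand₀₁` over the half-line. Truncating
it at `Y n` and taking `(1 - I / (n + 1)) ^ (n + 1)` gives transforms of probability measures that
converge to the exponential. -/
lemma exp_neg_const_mul_rpow {p : ℝ} (hp : p ∈ Ioo (0 : ℝ) 1) :
    ∃ c : ℝ, 0 < c ∧ IsLaplaceOfProb (fun s => Real.exp (-(c * s ^ p))) := by
  let C := ∫ t in Ioi 0, Real.rpowIntegrand₀₁ p t 1
  have hp0 := hp.1
  refine ⟨C, Real.integral_rpowIntegrand₀₁_one_pos hp, ?_⟩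
  -- Chosen so that `p / Y n ^ p = 1 / (n + 1)`.
  let Y : ℕ → ℝ := fun n => (p * (n + 1)) ^ (1 / p)
  have hY : ∀ n, 0 < Y n := fun n => by positivity
  have hYp : ∀ n, p / Y n ^ p = 1 / (n + 1) := fun n => by
    simp only [Y]
    rw [← Real.rpow_mul (by positivity), one_div_mul_cancel hp0.ne', Real.rpow_one]
    field_simp
  refine of_tendsto (fun n => (one_sub_integral_rpowIntegrand hp (hY n)).pow (n + 1))
    fun s hs => ?_
  have hYt : Tendsto Y atTop atTop :=
    (tendsto_rpow_atTop (by positivity)).comp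
      ((tendsto_atTop_add_const_right _ _ tendsto_natCast_atTop_atTop).const_mul_atTop hp0)
  have hI : Tendsto (fun n => ∫ y in Ioc 0 (Y n), Real.rpowIntegrand₀₁ p y s) atTop
      (𝓝 (C * s ^ p)) := by
    rw [mul_comm, ← Real.integral_rpowIntegrand₀₁_eq_rpow_mul_const hp hs.le]
    refine (intervalIntegral_tendsto_integral_Ioi 0
      (Real.integrableOn_rpowIntegrand₀₁_Ioi hp hs.le) hYt).congr fun n => ?_
    exact intervalIntegral.integral_of_le (hY n).le
  -- The exponential limit is used in the form `(1 + g m) ^ m`, hence the shift `m = n + 1`; the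
  -- value at `m = 0` plays no role.
  let g : ℕ → ℝ := fun m => -(1 / m) * ∫ y in Ioc 0 (Y (m - 1)), Real.rpowIntegrand₀₁ p y s
  have hg : Tendsto (fun m : ℕ => m * g m) atTop (𝓝 (-(C * s ^ p))) := by
    rw [← tendsto_add_atTop_iff_nat 1]
    refine hI.neg.congr fun n => ?_
    simp only [g, Nat.add_sub_cancel]
    have : ((n + 1 : ℕ) : ℝ) ≠ 0 := by positivity
    field_simp
  have := (tendsto_add_atTop_iff_nat 1).2 (Real.tendsto_one_add_pow_exp_of_tendsto hg)
  refine this.congr fun n => ?_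
  simp only [g, Nat.add_sub_cancel, hYp]
  push_cast
  ring

end IsLaplaceOfProb

/-- Existence of the one-sided `γ`-stable law. -/
lemma exists_stable_measure {γ : ℝ} (hγ : 0 < γ) (hγ' : γ ≤ 1) :
    ∃ σ : Measure ℝ, IsProbabilityMeasure σ ∧ (∀ᵐ x ∂σ, 0 < x) ∧
      ∀ s : ℝ, 0 < s → ∫ x, Real.exp (-(s * x)) ∂σ = Real.exp (-s ^ γ) := by
  rcases hγ'.eq_or_lt with rfl | hγ1
  · exact ⟨Measure.dirac 1, inferInstance, by simp, fun s _ => by simp⟩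
  obtain ⟨c, hc, μ, hμp, hμ⟩ := IsLaplaceOfProb.exp_neg_const_mul_rpow ⟨hγ, hγ1⟩
  simp only at hμ
  -- No mass at `y = ∞`: as `s → 0`, `x ^ s` tends to the indicator of `x ≠ 0`, while the transform
  -- tends to 1.
  have hpos : ∀ᵐ x ∂μ, x ≠ 0 := by
    have hlim : Tendsto (fun n : ℕ => ∫ x : unitInterval, (x : ℝ) ^ (1 / ((n : ℝ) + 1)) ∂μ) atTop
        (𝓝 (∫ x : unitInterval, ({0}ᶜ : Set unitInterval).indicator (fun _ => (1 : ℝ)) x ∂μ)) := by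
      refine tendsto_integral_of_dominated_convergence (fun _ => 1)
        (fun n => (Measurable.pow_const measurable_subtype_coe _).aestronglyMeasurable)
        (integrable_const _) (fun n => ae_of_all _ fun x => ?_) (ae_of_all _ fun x => ?_)
      · rw [Real.norm_of_nonneg (Real.rpow_nonneg x.2.1 _)]
        exact Real.rpow_le_one x.2.1 x.2.2 (by positivity)
      · rcases eq_or_ne x 0 with rfl | hx
        · have h0 : ∀ n : ℕ, (0 : ℝ) ^ (1 / ((n : ℝ) + 1)) = 0 := fun n =>
            Real.zero_rpow (by positivity)
          simp only [Set.Icc.coe_zero, h0]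
          simp
        · have hx' : (x : ℝ) ≠ 0 := fun h => hx (Subtype.ext h)
          have := (Real.continuousAt_const_rpow (b := 0) hx').tendsto.comp
            (tendsto_one_div_add_atTop_nhds_zero_nat (𝕜 := ℝ))
          simpa [hx, Function.comp_def] using this
    have hlim' : Tendsto (fun n : ℕ => ∫ x : unitInterval, (x : ℝ) ^ (1 / ((n : ℝ) + 1)) ∂μ) atTop
        (𝓝 1) := by
      have h1 : Tendsto (fun n : ℕ => Real.exp (-(c * (1 / ((n : ℝ) + 1)) ^ γ))) atTop (𝓝 1) := by
        have hcont : Continuous fun s : ℝ => Real.exp (-(c * s ^ γ)) :=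
          Real.continuous_exp.comp
            (continuous_const.mul (Real.continuous_rpow_const hγ.le)).neg
        have := (hcont.tendsto 0).comp (tendsto_one_div_add_atTop_nhds_zero_nat (𝕜 := ℝ))
        simpa [Real.zero_rpow hγ.ne', Function.comp_def] using this
      exact h1.congr fun n => (hμ _ (by positivity)).symm
    have h1 := tendsto_nhds_unique hlim hlim'
    rw [integral_indicator (by measurability)] at h1
    simp only [integral_const, smul_eq_mul, mul_one, measureReal_restrict_apply_univ] at h1
    rw [probReal_compl_eq_one_sub (by measurability), sub_eq_self, measureReal_eq_zero_iff] at h1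
    exact compl_mem_ae_iff.2 h1
  -- No mass at `y = 0`: the atom at `x = 1` is bounded by the transform, which tends to 0 as `s →
  -- ∞`.
  have hne1 : ∀ᵐ x ∂μ, x ≠ 1 := by
    have hlim : Tendsto (fun n : ℕ => Real.exp (-(c * ((n : ℝ) + 1) ^ γ))) atTop (𝓝 0) :=
      Real.tendsto_exp_neg_atTop_nhds_zero.comp
        (((tendsto_rpow_atTop hγ).comp
          (tendsto_atTop_add_const_right _ _ tendsto_natCast_atTop_atTop)).const_mul_atTop hc)
    have hle : ∀ n : ℕ, μ.real {1} ≤ Real.exp (-(c * ((n : ℝ) + 1) ^ γ)) := by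
      intro n
      rw [← hμ _ (by positivity)]
      have : μ.real {1} = ∫ x, ({1} : Set unitInterval).indicator (fun _ => (1 : ℝ)) x ∂μ := by
        rw [integral_indicator (by measurability)]; simp [Measure.real]
      rw [this]
      refine integral_mono ((integrable_const _).indicator (by measurability)) ?_ fun x => ?_
      · refine Integrable.of_bound
          (Measurable.pow_const measurable_subtype_coe _).aestronglyMeasurable 1
          (ae_of_all _ fun x => ?_)
        rw [Real.norm_of_nonneg (Real.rpow_nonneg x.2.1 _)]
        exact Real.rpow_le_one x.2.1 x.2.2 (by positivity)
      · refine indicator_le' (fun y hy => ?_) (fun y _ => Real.rpow_nonneg y.2.1 _) x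
        rw [mem_singleton_iff.1 hy]
        simp
    have h1 : μ.real {1} = 0 := le_antisymm (ge_of_tendsto' hlim hle) measureReal_nonneg
    rw [measureReal_eq_zero_iff] at h1
    exact compl_mem_ae_iff.2 h1
  -- Rescaling `y` by `a` normalises the constant: `c * (s * a) ^ γ = s ^ γ`.
  let a := c ^ (-(1 / γ))
  have ha : 0 < a := by positivity
  have hm : Measurable fun x : unitInterval => -(a * Real.log x) := by fun_prop
  refine ⟨μ.map fun x : unitInterval => -(a * Real.log x),
    Measure.isProbabilityMeasure_map hm.aemeasurable, ?_, fun s hs => ?_⟩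
  · rw [ae_map_iff hm.aemeasurable measurableSet_Ioi]
    filter_upwards [hpos, hne1] with x h0 h1
    have h0' : 0 < (x : ℝ) := unitInterval.pos_iff_ne_zero.2 h0
    have h1' : (x : ℝ) < 1 := unitInterval.lt_one_iff_ne_one.2 h1
    have := Real.log_neg h0' h1'
    nlinarith
  · rw [integral_map hm.aemeasurable (by fun_prop)]
    have : c * (s * a) ^ γ = s ^ γ := by
      simp only [a]
      rw [Real.mul_rpow hs.le ha.le, ← Real.rpow_mul hc.le]
      have : -(1 / γ) * γ = -1 := by field_simp
      rw [this, Real.rpow_neg_one]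
      field_simp
    rw [← this, ← hμ (s * a) (by positivity)]
    refine integral_congr_ae ?_
    filter_upwards [hpos] with x h0
    have h0' : 0 < (x : ℝ) := unitInterval.pos_iff_ne_zero.2 h0
    rw [Real.rpow_def_of_pos h0']
    ring_nf

/-! ### Fourier transform of the stable law and the Riesz-Feller symbol. -/

/-- The Laplace transform of a stable law extends from `(0, ∞)` to the open half plane. -/
lemma complexMGF_eq_exp_neg_cpow {σ : Measure ℝ} [IsProbabilityMeasure σ] {γ : ℝ}
    (hpos : ∀ᵐ x ∂σ, 0 < x)
    (hσ : ∀ s : ℝ, 0 < s → ∫ x, Real.exp (-(s * x)) ∂σ = Real.exp (-s ^ γ))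
    {z : ℂ} (hz : z.re < 0) :
    ProbabilityTheory.complexMGF id σ z = Complex.exp (-(-z) ^ (γ : ℂ)) := by
  have hexp : Iic 0 ⊆ ProbabilityTheory.integrableExpSet id σ := fun s hs => by
    refine Integrable.of_bound (by fun_prop) 1 ?_
    filter_upwards [hpos] with x hx
    rw [Real.norm_of_nonneg (Real.exp_pos _).le, Real.exp_le_one_iff]
    exact mul_nonpos_of_nonpos_of_nonneg hs hx.le
  have hint : Iio 0 ⊆ interior (ProbabilityTheory.integrableExpSet id σ) := by
    rw [← interior_Iic]
    exact interior_mono hexp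
  let D : Set ℂ := {z | z.re < 0}
  have hD : IsOpen D := isOpen_lt Complex.continuous_re continuous_const
  have hDc : Convex ℝ D := convex_halfSpace_re_lt 0
  have h1 : AnalyticOnNhd ℂ (ProbabilityTheory.complexMGF id σ) D := fun w hw =>
    ProbabilityTheory.analyticAt_complexMGF (hint hw)
  have h2 : AnalyticOnNhd ℂ (fun w : ℂ => Complex.exp (-(-w) ^ (γ : ℂ))) D := by
    refine DifferentiableOn.analyticOnNhd (fun w hw => DifferentiableAt.differentiableWithinAt ?_) hD
    have hw0 : w.re < 0 := hw
    have hw1 : -w ∈ Complex.slitPlane := Or.inl (by simpa using hw0)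
    exact ((differentiableAt_id.neg.cpow_const hw1).neg).cexp
  have heq : ∀ s : ℝ, 0 < s → ProbabilityTheory.complexMGF id σ ((-s : ℝ) : ℂ)
      = Complex.exp (-(-((-s : ℝ) : ℂ)) ^ (γ : ℂ)) := by
    intro s hs
    rw [ProbabilityTheory.complexMGF_ofReal]
    have : ProbabilityTheory.mgf id σ (-s) = Real.exp (-s ^ γ) := by
      rw [← hσ s hs]; simp [ProbabilityTheory.mgf]
    rw [this, Complex.ofReal_neg, neg_neg, ← Complex.ofReal_cpow hs.le, ← Complex.ofReal_neg,
      Complex.ofReal_exp]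
  -- Identity theorem: both sides agree on the negative axis, which accumulates at `-1`.
  refine h1.eqOn_of_preconnected_of_frequently_eq h2 hDc.isPreconnected
    (z₀ := ((-1 : ℝ) : ℂ)) (by simp [D]) ?_ hz
  have ht : Tendsto (fun n : ℕ => ((-(1 + 1 / ((n : ℝ) + 1)) : ℝ) : ℂ)) atTop
      (𝓝[≠] ((-1 : ℝ) : ℂ)) := by
    refine tendsto_nhdsWithin_iff.2 ⟨?_, .of_forall fun n => ?_⟩
    · refine (Complex.continuous_ofReal.tendsto _).comp ?_
      have := (tendsto_one_div_add_atTop_nhds_zero_nat (𝕜 := ℝ)).const_add 1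
      simpa using this.neg
    · have : (0 : ℝ) < 1 / ((n : ℝ) + 1) := by positivity
      simp only [mem_compl_iff, mem_singleton_iff, Complex.ofReal_inj]
      linarith
  exact ht.frequently (Eventually.of_forall fun n => heq _ (by positivity)).frequently

/-- The principal argument of `-iκ` is `-(sign κ) π / 2`; this is where the extremal asymmetry `θ =
-γ` comes from. -/
lemma neg_cpow_eq_rieszFellerSymbol {γ κ : ℝ} (hκ : κ ≠ 0) :
    -(-(κ * Complex.I)) ^ (γ : ℂ) = rieszFellerSymbol γ (-γ) κ := by
  have hI : (-Complex.I) ≠ 0 := by simp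
  unfold rieszFellerSymbol
  congr 1
  rcases lt_or_gt_of_ne hκ with h | h
  · have e : -(κ * Complex.I) = ((-κ : ℝ) : ℂ) * Complex.I := by push_cast; ring
    have hk : 0 < -κ := by linarith
    rw [e, Complex.cpow_def_of_ne_zero (mul_ne_zero (by exact_mod_cast hk.ne') Complex.I_ne_zero),
      Complex.log_ofReal_mul hk Complex.I_ne_zero, add_mul, Complex.exp_add, Complex.log_I,
      abs_of_neg h, sign_neg h, Real.rpow_def_of_pos hk]
    push_cast
    congr 2
    simp
    ring
  · have e : -(κ * Complex.I) = (κ : ℂ) * (-Complex.I) := by ring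
    rw [e, Complex.cpow_def_of_ne_zero (mul_ne_zero (by exact_mod_cast h.ne') hI),
      Complex.log_ofReal_mul h hI, add_mul, Complex.exp_add, Complex.log_neg_I,
      abs_of_pos h, sign_pos h, Real.rpow_def_of_pos h]
    push_cast
    congr 2
    simp
    ring

/-- The imaginary axis bounds the half plane of analyticity; the formula passes to the boundary by
dominated convergence, as `κ ≠ 0` keeps `-iκ` off the branch cut. -/
lemma charFun_stable {σ : Measure ℝ} [IsProbabilityMeasure σ] {γ : ℝ} (hγ : 0 < γ)
    (hpos : ∀ᵐ x ∂σ, 0 < x)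
    (hσ : ∀ s : ℝ, 0 < s → ∫ x, Real.exp (-(s * x)) ∂σ = Real.exp (-s ^ γ)) (κ : ℝ) :
    charFun σ κ = Complex.exp (rieszFellerSymbol γ (-γ) κ) := by
  rcases eq_or_ne κ 0 with rfl | hκ
  · simp [rieszFellerSymbol, Real.zero_rpow hγ.ne']
  rw [← neg_cpow_eq_rieszFellerSymbol hκ, ← ProbabilityTheory.complexMGF_id_mul_I]
  let w : ℕ → ℂ := fun n => κ * Complex.I - ((1 / ((n : ℝ) + 1) : ℝ) : ℂ)
  have hw : Tendsto w atTop (𝓝 (κ * Complex.I)) := by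
    have := (Complex.continuous_ofReal.tendsto 0).comp
      (tendsto_one_div_add_atTop_nhds_zero_nat (𝕜 := ℝ))
    simpa [w, Function.comp_def] using this.const_sub (κ * Complex.I)
  have hwre : ∀ n, (w n).re < 0 := fun n => by
    have : (0 : ℝ) < 1 / ((n : ℝ) + 1) := by positivity
    simp only [w, Complex.sub_re, Complex.ofReal_re]
    simpa using this
  have h1 : Tendsto (fun n => ProbabilityTheory.complexMGF id σ (w n)) atTop
      (𝓝 (ProbabilityTheory.complexMGF id σ (κ * Complex.I))) := by
    refine tendsto_integral_of_dominated_convergence (fun _ => 1) (fun n => by fun_prop)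
      (integrable_const _) (fun n => ?_) (ae_of_all _ fun x => ?_)
    · filter_upwards [hpos] with x hx
      rw [Complex.norm_exp, Real.exp_le_one_iff]
      simp only [id, Complex.mul_re, Complex.ofReal_re, Complex.ofReal_im, mul_zero, sub_zero]
      exact mul_nonpos_of_nonpos_of_nonneg (hwre n).le hx.le
    · exact (Complex.continuous_exp.tendsto _).comp (hw.mul_const _)
  refine tendsto_nhds_unique h1 ?_
  have hs : -(κ * Complex.I) ∈ Complex.slitPlane := Or.inr (by simpa using hκ)
  have hc : ContinuousAt (fun z : ℂ => Complex.exp (-(-z) ^ (γ : ℂ))) (κ * Complex.I) :=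
    ((continuousAt_id.neg.cpow continuousAt_const hs).neg).cexp
  exact (hc.tendsto.comp hw).congr fun n => (complexMGF_eq_exp_neg_cpow hpos hσ (hwre n)).symm

lemma rieszFellerSymbol_const_mul {α θ a : ℝ} (hα : 0 < α) (ha : 0 ≤ a) (κ : ℝ) :
    rieszFellerSymbol α θ (a * κ) = ((a ^ α : ℝ) : ℂ) * rieszFellerSymbol α θ κ := by
  rcases ha.eq_or_lt with rfl | ha'
  · simp [rieszFellerSymbol, Real.zero_rpow hα.ne']
  · simp only [rieszFellerSymbol, abs_mul, abs_of_pos ha', sign_mul, sign_pos ha', one_mul,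
      Real.mul_rpow ha (abs_nonneg κ)]
    push_cast
    ring

lemma rieszFellerSymbol_zero_theta (α κ : ℝ) :
    rieszFellerSymbol α 0 κ = ((-|κ| ^ α : ℝ) : ℂ) := by
  simp [rieszFellerSymbol]

/-- For `γ ≤ 1` the phase stays within `[-π / 2, π / 2]`, so its cosine is nonnegative. -/
lemma re_rieszFellerSymbol_nonpos {γ : ℝ} (hγ : 0 < γ) (hγ' : γ ≤ 1) (κ : ℝ) :
    (rieszFellerSymbol γ (-γ) κ).re ≤ 0 := by
  have hcos : 0 ≤ Real.cos ((SignType.sign κ : ℝ) * -γ * Real.pi / 2) := by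
    have hp := Real.pi_pos
    have h : γ * Real.pi ≤ Real.pi := by nlinarith
    have h' : 0 < γ * Real.pi := by positivity
    apply Real.cos_nonneg_of_mem_Icc
    rcases lt_trichotomy κ 0 with hk | rfl | hk
    · constructor <;> simp [sign_neg hk] <;> linarith
    · constructor <;> simp <;> linarith
    · constructor <;> simp [sign_pos hk] <;> linarith
  unfold rieszFellerSymbol
  rw [mul_comm Complex.I, Complex.neg_re, Complex.re_ofReal_mul, Complex.exp_ofReal_mul_I_re]
  have := mul_nonneg (Real.rpow_nonneg (abs_nonneg κ) γ) hcos
  linarith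

/-! ### Mittag-Leffler functions as stable averages, and their Caputo derivative. -/

/-- Laplace transform of `v ↦ exp (ψ v ^ β)`, by parts and the substitution `u = v ^ β`. -/
lemma mul_integral_exp_neg_mul_mul_exp_rpow {a β : ℝ} {ψ : ℂ} (ha : 0 < a) (hβ : 0 < β)
    (hψ : ψ.re ≤ 0) :
    a * ∫ v in Ioi (0 : ℝ), (Real.exp (-(a * v)) : ℂ) * Complex.exp (ψ * ((v ^ β : ℝ) : ℂ))
      = 1 + ψ * ∫ u in Ioi (0 : ℝ),
          (Real.exp (-(a * u ^ (1 / β))) : ℂ) * Complex.exp (ψ * (u : ℂ)) := by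
  let U : ℝ → ℂ := fun v => (-Real.exp (-(a * v)) : ℝ)
  let U' : ℝ → ℂ := fun v => (a * Real.exp (-(a * v)) : ℝ)
  let V : ℝ → ℂ := fun v => Complex.exp (ψ * ((v ^ β : ℝ) : ℂ))
  let V' : ℝ → ℂ := fun v => Complex.exp (ψ * ((v ^ β : ℝ) : ℂ)) * (ψ * ((β * v ^ (β - 1) : ℝ) : ℂ))
  have hVnorm : ∀ v : ℝ, 0 ≤ v → ‖V v‖ ≤ 1 := fun v hv => by
    simp only [V]
    rw [Complex.norm_exp, Real.exp_le_one_iff, mul_comm, Complex.re_ofReal_mul]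
    exact mul_nonpos_of_nonneg_of_nonpos (Real.rpow_nonneg hv β) hψ
  have hVm : Measurable V := by fun_prop
  have hV'm : Measurable V' := by fun_prop
  have hUm : Measurable U := by fun_prop
  have hU'm : Measurable U' := by fun_prop
  have hU : ∀ x ∈ Ioi (0 : ℝ), HasDerivAt U (U' x) x := fun x _ => by
    have : HasDerivAt (fun v : ℝ => -Real.exp (-(a * v))) (a * Real.exp (-(a * x))) x := by
      have h := (((hasDerivAt_id x).const_mul a).neg.exp).neg
      convert! h using 1
      simp; ring
    exact this.ofReal_comp
  have hV : ∀ x ∈ Ioi (0 : ℝ), HasDerivAt V (V' x) x := fun x hx => by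
    have h := (Real.hasDerivAt_rpow_const (p := β) (Or.inl (ne_of_gt hx))).ofReal_comp
    exact (h.const_mul ψ).cexp
  -- `V'` may blow up at 0, but only like `v ^ (β - 1)`, which is integrable since `β > 0`.
  have hUV' : IntegrableOn (U * V') (Ioi 0) := by
    have h := (integrableOn_rpow_mul_exp_neg_mul_rpow (s := β - 1) (p := 1) (by linarith)
      one_pos ha).const_mul (‖ψ‖ * β)
    refine h.mono' (hUm.mul hV'm).aestronglyMeasurable
      (ae_restrict_of_forall_mem measurableSet_Ioi fun v hv => ?_)
    have hv0 : (0 : ℝ) ≤ v := le_of_lt hv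
    have := hVnorm v hv0
    simp only [Pi.mul_apply, norm_mul, U, V', V] at this ⊢
    rw [Complex.norm_real, Complex.norm_real, norm_neg, Real.norm_of_nonneg (Real.exp_pos _).le,
      Real.norm_of_nonneg (by positivity), Real.rpow_one, neg_mul]
    calc _ ≤ Real.exp (-(a * v)) * (1 * (‖ψ‖ * (β * v ^ (β - 1)))) := by gcongr
      _ = _ := by ring
  have hU'V : IntegrableOn (U' * V) (Ioi 0) := by
    refine ((exp_neg_integrableOn_Ioi 0 ha).const_mul a).mono'
      (hU'm.mul hVm).aestronglyMeasurable
      (ae_restrict_of_forall_mem measurableSet_Ioi fun v hv => ?_)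
    have := hVnorm v (le_of_lt hv)
    simp only [Pi.mul_apply, norm_mul, U']
    rw [Complex.norm_real, Real.norm_of_nonneg (by positivity), neg_mul]
    exact mul_le_of_le_one_right (by positivity) this
  have h0 : Tendsto (U * V) (𝓝[>] 0) (𝓝 (-1)) := by
    have hc : Continuous (U * V) := by
      have : Continuous fun v : ℝ => v ^ β := Real.continuous_rpow_const hβ.le
      exact Continuous.mul (by fun_prop) (by fun_prop)
    have := (hc.tendsto 0).mono_left (nhdsWithin_le_nhds (s := Ioi 0))
    simpa [U, V, Real.zero_rpow hβ.ne'] using this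
  have h1 : Tendsto (U * V) atTop (𝓝 0) := by
    have h2 : Tendsto (fun v : ℝ => Real.exp (-(a * v))) atTop (𝓝 0) :=
      Real.tendsto_exp_neg_atTop_nhds_zero.comp (tendsto_id.const_mul_atTop ha)
    refine squeeze_zero_norm' ?_ h2
    filter_upwards [eventually_ge_atTop 0] with v hv
    simp only [Pi.mul_apply, norm_mul, U]
    rw [Complex.norm_real, norm_neg, Real.norm_of_nonneg (Real.exp_pos _).le]
    exact mul_le_of_le_one_right (Real.exp_pos _).le (hVnorm v hv)
  have key := integral_Ioi_mul_deriv_eq_deriv_mul hU hV hUV' hU'V h0 h1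
  have hl : (a : ℂ) * ∫ v in Ioi (0 : ℝ), (Real.exp (-(a * v)) : ℂ) *
      Complex.exp (ψ * ((v ^ β : ℝ) : ℂ)) = ∫ v in Ioi (0 : ℝ), U' v * V v := by
    rw [← integral_const_mul]
    refine integral_congr_ae (ae_of_all _ fun v => ?_)
    simp only [U', V]
    push_cast
    ring
  have hr : ψ * ∫ u in Ioi (0 : ℝ), (Real.exp (-(a * u ^ (1 / β))) : ℂ) * Complex.exp (ψ * (u : ℂ))
      = -∫ v in Ioi (0 : ℝ), U v * V' v := by
    rw [← integral_comp_rpow_Ioi_of_pos hβ, ← integral_const_mul, ← integral_neg]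
    refine setIntegral_congr_fun measurableSet_Ioi fun v hv => ?_
    simp only [U, V']
    rw [← Real.rpow_mul (le_of_lt hv), mul_one_div_cancel hβ.ne', Real.rpow_one, Complex.real_smul]
    push_cast
    ring
  rw [hl, hr, key]
  ring

lemma laplaceTransformable_of_bounded {f : ℝ≥0 → ℂ} {C : ℝ} (hf : Continuous f)
    (hC : ∀ t, ‖f t‖ ≤ C) : LaplaceTransformable f := by
  intro s hs
  have hm : Continuous (fun t : ℝ => (Real.exp (-(s * t)) : ℂ) * f t.toNNReal) := by
    have := hf.comp continuous_real_toNNReal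
    exact Continuous.mul (by fun_prop) this
  refine ((exp_neg_integrableOn_Ioi 0 hs).const_mul C).mono' hm.aestronglyMeasurable
    (ae_of_all _ fun t => ?_)
  rw [norm_mul, Complex.norm_real, Real.norm_of_nonneg (Real.exp_pos _).le, neg_mul, mul_comm]
  exact mul_le_mul_of_nonneg_right (hC _) (Real.exp_pos _).le

lemma laplaceTransform_const_mul (c : ℂ) (f : ℝ≥0 → ℂ) (s : ℝ) :
    laplaceTransform (fun t => c * f t) s = c * laplaceTransform f s := by
  simp only [laplaceTransform]
  rw [← integral_const_mul]
  refine integral_congr_ae (ae_of_all _ fun t => ?_)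
  simp only
  ring

section MittagLeffler

variable {σ : Measure ℝ} [IsProbabilityMeasure σ] {β : ℝ} {ψ : ℂ}

lemma norm_exp_mul_rpow_le_one (hψ : ψ.re ≤ 0) {x : ℝ} (hx : 0 ≤ x) :
    ‖Complex.exp (ψ * ((x ^ β : ℝ) : ℂ))‖ ≤ 1 := by
  rw [Complex.norm_exp, Real.exp_le_one_iff, mul_comm, Complex.re_ofReal_mul]
  exact mul_nonpos_of_nonneg_of_nonpos (Real.rpow_nonneg hx β) hψ

lemma norm_mittagLeffler_le_one (hpos : ∀ᵐ y ∂σ, 0 < y) (hψ : ψ.re ≤ 0) (t : ℝ≥0) :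
    ‖∫ y, Complex.exp (ψ * ((((t : ℝ) / y) ^ β : ℝ) : ℂ)) ∂σ‖ ≤ 1 := by
  refine (norm_integral_le_of_norm_le_const (C := 1) ?_).trans (by simp)
  filter_upwards [hpos] with y hy
  exact norm_exp_mul_rpow_le_one hψ (div_nonneg t.2 hy.le)

lemma continuous_mittagLeffler (hβ : 0 < β) (hpos : ∀ᵐ y ∂σ, 0 < y) (hψ : ψ.re ≤ 0) :
    Continuous fun t : ℝ≥0 => ∫ y, Complex.exp (ψ * ((((t : ℝ) / y) ^ β : ℝ) : ℂ)) ∂σ := by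
  refine continuous_of_dominated (bound := fun _ => 1)
    (fun t => Measurable.aestronglyMeasurable (by fun_prop)) (fun t => ?_) (integrable_const _)
    (ae_of_all _ fun y => ?_)
  · filter_upwards [hpos] with y hy
    exact norm_exp_mul_rpow_le_one hψ (div_nonneg t.2 hy.le)
  · have : Continuous fun t : ℝ≥0 => ((t : ℝ) / y) ^ β :=
      (NNReal.continuous_coe.div_const y).rpow_const fun _ => Or.inr hβ.le
    fun_prop

/-- For fixed `y`, integration by parts turns the time integral into one of `exp (-s y u ^ (1 / β))
exp (ψ u)`. Averaging over `y` replaces the first factor by `exp (-s ^ β u)`, and an elementary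
exponential integral remains. -/
lemma mul_laplaceTransform_mittagLeffler (hβ : 0 < β) (hpos : ∀ᵐ y ∂σ, 0 < y)
    (hσ : ∀ s : ℝ, 0 < s → ∫ x, Real.exp (-(s * x)) ∂σ = Real.exp (-s ^ β)) (hψ : ψ.re ≤ 0)
    {s : ℝ} (hs : 0 < s) :
    s * laplaceTransform
        (fun t : ℝ≥0 => ∫ y, Complex.exp (ψ * ((((t : ℝ) / y) ^ β : ℝ) : ℂ)) ∂σ) s
      = 1 + ψ / (((s ^ β : ℝ) : ℂ) - ψ) := by
  have hsβ : 0 < s ^ β := Real.rpow_pos_of_pos hs β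
  have hJ : ∀ y : ℝ, 0 < y → s * ∫ t in Ioi (0 : ℝ), (Real.exp (-(s * t)) : ℂ) *
        Complex.exp (ψ * (((t / y) ^ β : ℝ) : ℂ))
      = 1 + ψ * ∫ u in Ioi (0 : ℝ),
          (Real.exp (-(s * y * u ^ (1 / β))) : ℂ) * Complex.exp (ψ * (u : ℂ)) := by
    intro y hy
    rw [← mul_integral_exp_neg_mul_mul_exp_rpow (mul_pos hs hy) hβ hψ]
    have h := integral_comp_mul_left_Ioi (fun t : ℝ => (Real.exp (-(s * t)) : ℂ) *
        Complex.exp (ψ * (((t / y) ^ β : ℝ) : ℂ))) 0 hy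
    rw [mul_zero] at h
    have h' : ∀ v : ℝ, y * v / y = v := fun v => by field_simp
    simp only [h', ← mul_assoc] at h
    have hy' : (y : ℂ) ≠ 0 := by exact_mod_cast hy.ne'
    rw [h, Complex.real_smul]
    push_cast
    field_simp
  have hint1 : Integrable (Function.uncurry fun (t y : ℝ) => (Real.exp (-(s * t)) : ℂ) *
      Complex.exp (ψ * (((t / y) ^ β : ℝ) : ℂ))) ((volume.restrict (Ioi 0)).prod σ) := by
    have hb : Integrable (fun q : ℝ × ℝ => Real.exp (-s * q.1) * (1 : ℝ))
        ((volume.restrict (Ioi 0)).prod σ) :=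
      (exp_neg_integrableOn_Ioi 0 hs).mul_prod (integrable_const 1)
    refine hb.mono' (Measurable.aestronglyMeasurable (by unfold Function.uncurry; fun_prop)) ?_
    have hp1 : ∀ᵐ q ∂(volume.restrict (Ioi (0 : ℝ))).prod σ, 0 < q.1 :=
      Measure.quasiMeasurePreserving_fst.ae (ae_restrict_mem measurableSet_Ioi)
    have hp2 : ∀ᵐ q ∂(volume.restrict (Ioi (0 : ℝ))).prod σ, 0 < q.2 :=
      Measure.quasiMeasurePreserving_snd.ae hpos
    filter_upwards [hp1, hp2] with q h1 h2
    simp only [Function.uncurry, norm_mul]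
    rw [Complex.norm_real, Real.norm_of_nonneg (Real.exp_pos _).le, neg_mul]
    exact mul_le_mul_of_nonneg_left (norm_exp_mul_rpow_le_one hψ (div_nonneg h1.le h2.le))
      (Real.exp_pos _).le
  have hin : ∀ u : ℝ, 0 < u → ∫ y, Real.exp (-(s * y * u ^ (1 / β))) ∂σ
      = Real.exp (-(s ^ β * u)) := by
    intro u hu
    have h := hσ (s * u ^ (1 / β)) (by positivity)
    rw [Real.mul_rpow hs.le (by positivity), ← Real.rpow_mul hu.le, one_div_mul_cancel hβ.ne',
      Real.rpow_one] at h
    rw [← h]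
    refine integral_congr_ae (ae_of_all _ fun y => ?_)
    simp only
    ring_nf
  have hint2 : Integrable (Function.uncurry fun (y u : ℝ) =>
      (Real.exp (-(s * y * u ^ (1 / β))) : ℂ) * Complex.exp (ψ * (u : ℂ)))
      (σ.prod (volume.restrict (Ioi 0))) := by
    have hm : AEStronglyMeasurable (Function.uncurry fun (y u : ℝ) =>
      (Real.exp (-(s * y * u ^ (1 / β))) : ℂ) * Complex.exp (ψ * (u : ℂ)))
      (σ.prod (volume.restrict (Ioi 0))) :=
      Measurable.aestronglyMeasurable (by unfold Function.uncurry; fun_prop)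
    -- Integrating the modulus over `y` first gives at most `exp (-s ^ β u)`. This supplies the
    -- decay in `u`, which `exp (ψ u)` lacks when `Re ψ = 0`.
    refine (integrable_prod_iff' hm).2
      ⟨ae_restrict_of_forall_mem measurableSet_Ioi fun u hu => ?_, ?_⟩
    · simp only [Function.uncurry]
      refine Integrable.mul_const ?_ _
      refine Integrable.of_bound (Measurable.aestronglyMeasurable (by fun_prop)) 1 ?_
      filter_upwards [hpos] with y hy
      rw [Complex.norm_real, Real.norm_of_nonneg (Real.exp_pos _).le, Real.exp_le_one_iff]
      have : 0 ≤ s * y * u ^ (1 / β) := mul_nonneg (by positivity) (Real.rpow_nonneg (le_of_lt hu) _)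
      linarith
    · refine (exp_neg_integrableOn_Ioi 0 hsβ).mono' 
        hm.norm.prod_swap.integral_prod_right'
        (ae_restrict_of_forall_mem measurableSet_Ioi fun u hu => ?_)
      rw [Real.norm_of_nonneg (integral_nonneg fun _ => norm_nonneg _), neg_mul, ← hin u hu]
      refine integral_mono_of_nonneg (ae_of_all _ fun _ => norm_nonneg _) ?_
        (ae_of_all _ fun y => ?_)
      -- A non-integrable function has integral 0 by convention, whereas `hin` gives a positive
      -- value.
      · by_contra hni
        have h := hin u hu
        rw [integral_undef hni] at h
        exact (Real.exp_pos _).ne h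
      · simp only [Function.uncurry, norm_mul]
        rw [Complex.norm_real, Real.norm_of_nonneg (Real.exp_pos _).le]
        refine mul_le_of_le_one_right (Real.exp_pos _).le ?_
        simpa using norm_exp_mul_rpow_le_one (β := 1) hψ (le_of_lt hu)
  have hfin : ∫ u in Ioi (0 : ℝ), (Real.exp (-(s ^ β * u)) : ℂ) * Complex.exp (ψ * (u : ℂ))
      = 1 / (((s ^ β : ℝ) : ℂ) - ψ) := by
    have hre : (ψ - ((s ^ β : ℝ) : ℂ)).re < 0 := by
      rw [Complex.sub_re, Complex.ofReal_re]; linarith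
    have h := integral_exp_mul_complex_Ioi hre 0
    simp only [Complex.ofReal_zero, mul_zero, Complex.exp_zero] at h
    rw [← neg_sub, one_div, inv_neg, ← one_div, ← neg_div, ← h]
    refine integral_congr_ae (ae_of_all _ fun u => ?_)
    simp only [Complex.ofReal_exp]
    rw [← Complex.exp_add]
    congr 1
    push_cast
    ring
  calc _ = (s : ℂ) * ∫ t in Ioi (0 : ℝ), ∫ y, (Real.exp (-(s * t)) : ℂ) *
        Complex.exp (ψ * (((t / y) ^ β : ℝ) : ℂ)) ∂σ := by
        congr 1
        refine setIntegral_congr_fun measurableSet_Ioi fun t ht => ?_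
        simp only [Real.coe_toNNReal t (le_of_lt ht)]
        rw [integral_const_mul]
    _ = ∫ y, (1 + ψ * ∫ u in Ioi (0 : ℝ),
          (Real.exp (-(s * y * u ^ (1 / β))) : ℂ) * Complex.exp (ψ * (u : ℂ))) ∂σ := by
        rw [integral_integral_swap hint1, ← integral_const_mul]
        refine integral_congr_ae ?_
        filter_upwards [hpos] with y hy
        exact hJ y hy
    _ = 1 + ψ * ∫ u in Ioi (0 : ℝ), ∫ y,
          (Real.exp (-(s * y * u ^ (1 / β))) : ℂ) * Complex.exp (ψ * (u : ℂ)) ∂σ := by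
        have h2 := hint2.integral_prod_left
        simp only [Function.uncurry] at h2
        rw [integral_add (integrable_const _) (h2.const_mul ψ),
          integral_const_mul, integral_integral_swap hint2]
        simp
    _ = 1 + ψ * ∫ u in Ioi (0 : ℝ),
          (Real.exp (-(s ^ β * u)) : ℂ) * Complex.exp (ψ * (u : ℂ)) := by
        congr 2
        refine setIntegral_congr_fun measurableSet_Ioi fun u hu => ?_
        rw [integral_mul_const, integral_complex_ofReal, hin u hu]
    _ = _ := by rw [hfin, mul_one_div]

/-- The transform is `s ^ (β - 1) / (s ^ β - ψ)`, which is the Caputo relation with initial value 1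
solved for the unknown. -/
lemma hasCaputoDeriv_mittagLeffler (hβ : 0 < β) (hpos : ∀ᵐ y ∂σ, 0 < y)
    (hσ : ∀ s : ℝ, 0 < s → ∫ x, Real.exp (-(s * x)) ∂σ = Real.exp (-s ^ β)) (hψ : ψ.re ≤ 0) :
    HasCaputoDeriv β
      (fun t : ℝ≥0 => ∫ y, Complex.exp (ψ * ((((t : ℝ) / y) ^ β : ℝ) : ℂ)) ∂σ)
      (fun t : ℝ≥0 => ψ * ∫ y, Complex.exp (ψ * ((((t : ℝ) / y) ^ β : ℝ) : ℂ)) ∂σ) := by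
  have hc := continuous_mittagLeffler (σ := σ) hβ hpos hψ
  have hb := norm_mittagLeffler_le_one (σ := σ) (β := β) hpos hψ
  refine ⟨laplaceTransformable_of_bounded hc hb,
    laplaceTransformable_of_bounded (C := ‖ψ‖) (continuous_const.mul hc) fun t => ?_, 1, ?_, ?_⟩
  · rw [norm_mul]
    exact mul_le_of_le_one_right (norm_nonneg _) (hb t)
  · have := (hc.tendsto 0).mono_left (nhdsWithin_le_nhds (s := Ioi 0))
    simpa [Real.zero_rpow hβ.ne'] using this
  · intro s hs
    rw [laplaceTransform_const_mul]
    have h := mul_laplaceTransform_mittagLeffler hβ hpos hσ hψ hs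
    have hs' : (s : ℂ) ≠ 0 := by exact_mod_cast hs.ne'
    have hne : ((s ^ β : ℝ) : ℂ) - ψ ≠ 0 := by
      intro h0
      have := congrArg Complex.re h0
      rw [Complex.sub_re, Complex.ofReal_re, Complex.zero_re] at this
      have := Real.rpow_pos_of_pos hs β
      linarith
    rw [mul_comm, ← eq_div_iff hs'] at h
    rw [h, Real.rpow_sub_one hs.ne']
    push_cast
    field_simp
    ring

end MittagLeffler

/-! ### Injectivity of the Laplace transform and uniqueness. -/

/-- A function on `(0, ∞)` is determined by its Laplace transform at the positive integers. -/
lemma ae_eq_zero_of_laplace_eq_zero {F : ℝ → ℂ}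
    (hF : ∀ n : ℕ, IntegrableOn (fun t : ℝ => (Real.exp (-((n + 1 : ℕ) * t)) : ℂ) * F t) (Ioi 0))
    (h0 : ∀ n : ℕ, ∫ t in Ioi (0 : ℝ), (Real.exp (-((n + 1 : ℕ) * t)) : ℂ) * F t = 0) :
    ∀ᵐ t : ℝ, t ∈ Ioi (0 : ℝ) → F t = 0 := by
  -- One factor `e^{-t}` goes into `G`, making it integrable; the hypotheses then say that `G` is
  -- orthogonal to all monomials in `e^{-t}`, and Weierstrass approximation applies.
  let G : ℝ → ℂ := fun t => (Real.exp (-t) : ℂ) * F t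
  have hpow : ∀ (n : ℕ) (t : ℝ), (Real.exp (-((n + 1 : ℕ) * t)) : ℂ) * F t
      = ((Real.exp (-t) ^ n : ℝ) : ℂ) * G t := fun n t => by
    simp only [G]
    rw [← mul_assoc, ← Complex.ofReal_mul, ← pow_succ, ← Real.exp_nat_mul]
    congr 3
    ring
  simp only [hpow] at hF h0
  have hG : IntegrableOn G (Ioi 0) := by simpa using hF 0
  have hpoly : ∀ p : Polynomial ℝ,
      IntegrableOn (fun t : ℝ => ((p.eval (Real.exp (-t)) : ℝ) : ℂ) * G t) (Ioi 0) ∧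
      ∫ t in Ioi (0 : ℝ), ((p.eval (Real.exp (-t)) : ℝ) : ℂ) * G t = 0 := by
    intro p
    induction p using Polynomial.induction_on' with
    | add p q hp hq =>
      simp only [Polynomial.eval_add, Complex.ofReal_add, add_mul]
      exact ⟨hp.1.add hq.1, by rw [integral_add hp.1 hq.1, hp.2, hq.2, add_zero]⟩
    | monomial n a =>
      simp only [Polynomial.eval_monomial, Complex.ofReal_mul, mul_assoc]
      exact ⟨(hF n).const_mul _, by rw [integral_const_mul, h0 n, mul_zero]⟩
  have hcont : ∀ φ : ℝ → ℝ, ContinuousOn φ (Icc 0 1) →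
      ∫ t in Ioi (0 : ℝ), ((φ (Real.exp (-t)) : ℝ) : ℂ) * G t = 0 := by
    intro φ hφ
    have hexp : ∀ t ∈ Ioi (0 : ℝ), Real.exp (-t) ∈ Icc (0 : ℝ) 1 := fun t ht =>
      ⟨(Real.exp_pos _).le, Real.exp_le_one_iff.2 (by simpa using le_of_lt ht)⟩
    have hφm : AEStronglyMeasurable (fun t : ℝ => ((φ (Real.exp (-t)) : ℝ) : ℂ))
        (volume.restrict (Ioi 0)) := by
      refine ContinuousOn.aestronglyMeasurable ?_ measurableSet_Ioi
      exact Complex.continuous_ofReal.comp_continuousOn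
        (hφ.comp (by fun_prop) hexp)
    obtain ⟨C, hC⟩ := isCompact_Icc.exists_bound_of_continuousOn hφ
    have hφi : IntegrableOn (fun t : ℝ => ((φ (Real.exp (-t)) : ℝ) : ℂ) * G t) (Ioi 0) :=
      hG.bdd_mul (c := C) hφm (ae_restrict_of_forall_mem measurableSet_Ioi fun t ht => by
        rw [Complex.norm_real]; exact hC _ (hexp t ht))
    let M := ∫ t in Ioi (0 : ℝ), ‖G t‖
    have hM : 0 ≤ M := integral_nonneg fun _ => norm_nonneg _
    rw [← norm_le_zero_iff]
    refine le_of_forall_pos_le_add fun ε hε => ?_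
    obtain ⟨p, hp⟩ := exists_polynomial_near_of_continuousOn 0 1 φ hφ (ε / (M + 1)) (by positivity)
    have hsub : ∫ t in Ioi (0 : ℝ), ((φ (Real.exp (-t)) : ℝ) : ℂ) * G t
        = ∫ t in Ioi (0 : ℝ), (((φ (Real.exp (-t)) : ℝ) : ℂ) * G t
            - ((p.eval (Real.exp (-t)) : ℝ) : ℂ) * G t) := by
      rw [integral_sub hφi (hpoly p).1, (hpoly p).2, sub_zero]
    rw [hsub]
    calc _ ≤ ∫ t in Ioi (0 : ℝ), ε / (M + 1) * ‖G t‖ := by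
          refine norm_integral_le_of_norm_le (hG.norm.const_mul _)
            (ae_restrict_of_forall_mem measurableSet_Ioi fun t ht => ?_)
          rw [← sub_mul, norm_mul, ← Complex.ofReal_sub, Complex.norm_real, norm_sub_rev]
          exact mul_le_mul_of_nonneg_right (hp _ (hexp t ht)).le (norm_nonneg _)
      _ = ε / (M + 1) * M := integral_const_mul _ _
      _ ≤ 0 + ε := by
          rw [div_mul_eq_mul_div, div_le_iff₀ (by positivity)]
          nlinarith
  have hGz : ∀ᵐ t : ℝ, t ∈ Ioi (0 : ℝ) → G t = 0 := by
    refine isOpen_Ioi.ae_eq_zero_of_integral_contDiff_smul_eq_zero hG.locallyIntegrableOn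
      fun g hg hgc hgU => ?_
    obtain ⟨R, hR⟩ := hgc.isCompact.isBounded.subset_closedBall 0
    have hg0 : ∀ x : ℝ, x ∉ Ioi (0 : ℝ) → g x = 0 := fun x hx =>
      image_eq_zero_of_notMem_tsupport fun h => hx (hgU h)
    have hgR : ∀ x : ℝ, R < |x| → g x = 0 := fun x hx =>
      image_eq_zero_of_notMem_tsupport fun h => by
        have := hR h
        rw [mem_closedBall_zero_iff, Real.norm_eq_abs] at this
        linarith
    -- The substitution `x = e^{-t}` makes a test function continuous up to `x = 0`, since its
    -- compact support kills large `t`. At `x = 0` itself the convention `log 0 = 0` gives `g 0`,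
    -- which vanishes too.
    have hφ : Continuous fun x : ℝ => g (-Real.log x) := by
      rw [continuous_iff_continuousAt]
      intro x
      rcases eq_or_ne x 0 with rfl | hx
      · have hev : (fun x : ℝ => g (-Real.log x)) =ᶠ[𝓝 0] fun _ => 0 := by
          have hev' : ∀ᶠ x : ℝ in 𝓝[≠] 0, g (-Real.log x) = 0 := by
            filter_upwards [Real.tendsto_log_nhdsNE_zero.eventually (eventually_lt_atBot (-|R|))]
              with x hx
            refine hgR _ ?_
            have := le_abs_self R
            have := le_abs_self (-Real.log x)
            linarith
          rw [eventually_nhdsWithin_iff] at hev'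
          filter_upwards [hev'] with x hx
          by_cases h : x = 0
          · simpa [h] using hg0 0 (by simp)
          · exact hx h
        exact continuousAt_const.congr hev.symm
      · exact hg.continuous.continuousAt.comp (Real.continuousAt_log hx).neg
    have h1 := hcont _ hφ.continuousOn
    simp only [Real.log_exp, neg_neg] at h1
    rw [← h1, ← integral_indicator measurableSet_Ioi]
    refine integral_congr_ae (ae_of_all _ fun t => ?_)
    by_cases ht : t ∈ Ioi (0 : ℝ)
    · simp [indicator_of_mem ht]
    · simp [indicator_of_notMem ht, hg0 t ht]
  filter_upwards [hGz] with t ht h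
  have := ht h
  simp only [G, mul_eq_zero, Complex.ofReal_eq_zero, (Real.exp_pos _).ne', false_or] at this
  exact this

lemma eq_of_laplaceTransform_eq {f g : ℝ≥0 → ℂ} (hf : Continuous f) (hg : Continuous g)
    (hfL : LaplaceTransformable f) (hgL : LaplaceTransformable g)
    (h : ∀ s : ℝ, 0 < s → laplaceTransform f s = laplaceTransform g s) : f = g := by
  have hae := ae_eq_zero_of_laplace_eq_zero
    (F := fun t : ℝ => f t.toNNReal - g t.toNNReal)
    (fun n => by
      simp only [mul_sub]
      exact (hfL _ (by positivity)).sub (hgL _ (by positivity)))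
    (fun n => by
      have hn : (0 : ℝ) < (n + 1 : ℕ) := by positivity
      simp only [mul_sub]
      rw [integral_sub (hfL _ hn) (hgL _ hn), sub_eq_zero]
      exact h _ hn)
  have hc : Continuous fun t : ℝ => f t.toNNReal - g t.toNNReal :=
    (hf.comp continuous_real_toNNReal).sub (hg.comp continuous_real_toNNReal)
  have heq : EqOn (fun t : ℝ => f t.toNNReal - g t.toNNReal) (fun _ => 0) (Ioi 0) := by
    refine Measure.eqOn_open_of_ae_eq (μ := volume) ?_ isOpen_Ioi hc.continuousOn
      continuousOn_const
    exact (ae_restrict_iff' measurableSet_Ioi).2 hae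
  have hcl : EqOn (fun t : ℝ => f t.toNNReal - g t.toNNReal) (fun _ => 0) (Ici 0) := by
    rw [← closure_Ioi]
    exact heq.closure hc continuous_const
  funext t
  have := hcl (x := (t : ℝ)) t.2
  simpa [sub_eq_zero] using this

/-- The equation reads `(s ^ β - ψ) f̃(s) = s ^ (β - 1) f(0)`, and `Re ψ ≤ 0` allows division by the
first factor. -/
lemma HasCaputoDeriv.eq_of_eigen {β : ℝ} {ψ : ℂ} {f g : ℝ≥0 → ℂ} (hψ : ψ.re ≤ 0)
    (hf : Continuous f) (hg : Continuous g) (hfg : f 0 = g 0)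
    (hfD : HasCaputoDeriv β f (fun t => ψ * f t)) (hgD : HasCaputoDeriv β g (fun t => ψ * g t)) :
    f = g := by
  have hlim : ∀ u : ℝ≥0 → ℂ, Continuous u → HasCaputoDeriv β u (fun t => ψ * u t) → ∀ s : ℝ,
      0 < s → (((s ^ β : ℝ) : ℂ) - ψ) * laplaceTransform u s = ((s ^ (β - 1) : ℝ) : ℂ) * u 0 := by
    rintro u hu ⟨-, -, u₀, hu₀, h⟩ s hs
    have e : u₀ = u 0 :=
      tendsto_nhds_unique hu₀ ((hu.tendsto 0).mono_left nhdsWithin_le_nhds)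
    have h1 := h s hs
    rw [laplaceTransform_const_mul, e] at h1
    rw [sub_mul, h1]
    ring
  refine eq_of_laplaceTransform_eq hf hg hfD.1 hgD.1 fun s hs => ?_
  have hne : ((s ^ β : ℝ) : ℂ) - ψ ≠ 0 := by
    intro h0
    have := congrArg Complex.re h0
    rw [Complex.sub_re, Complex.ofReal_re, Complex.zero_re] at this
    have := Real.rpow_pos_of_pos hs β
    linarith
  refine mul_left_cancel₀ hne ?_
  rw [hlim f hf hfD s hs, hlim g hg hgD s hs, hfg]

lemma continuous_charFun_of_continuous {K : ℝ≥0 → FiniteMeasure ℝ} (hK : Continuous K) (κ : ℝ) :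
    Continuous fun t => charFun (K t : Measure ℝ) κ := by
  have hre : Continuous fun x : ℝ => Real.cos (κ * x) := by fun_prop
  have him : Continuous fun x : ℝ => Real.sin (κ * x) := by fun_prop
  let c : BoundedContinuousFunction ℝ ℝ := BoundedContinuousFunction.ofNormedAddCommGroup _ hre 1
    fun x => Real.abs_cos_le_one _
  let d : BoundedContinuousFunction ℝ ℝ := BoundedContinuousFunction.ofNormedAddCommGroup _ him 1
    fun x => Real.abs_sin_le_one _
  have h1 : ∀ f : BoundedContinuousFunction ℝ ℝ, Continuous fun t => ∫ x, f x ∂(K t : Measure ℝ) :=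
    fun f => continuous_iff_continuousAt.2 fun t =>
      FiniteMeasure.tendsto_iff_forall_integral_tendsto.1 (hK.tendsto t) f
  have h2 : ∀ t, charFun (K t : Measure ℝ) κ = ((∫ x, c x ∂(K t : Measure ℝ) : ℝ) : ℂ)
      + ((∫ x, d x ∂(K t : Measure ℝ) : ℝ) : ℂ) * Complex.I := by
    intro t
    rw [charFun_apply_real, ← integral_complex_ofReal, ← integral_complex_ofReal,
      ← integral_mul_const, ← integral_add]
    · refine integral_congr_ae (ae_of_all _ fun x => ?_)
      simp only
      rw [← Complex.ofReal_mul, Complex.exp_mul_I, ← Complex.ofReal_cos, ← Complex.ofReal_sin]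
      rfl
    · exact (c.integrable (μ := (K t : Measure ℝ))).ofReal
    · exact (d.integrable (μ := (K t : Measure ℝ))).ofReal.mul_const _
  simp only [h2]
  have := h1 c
  have := h1 d
  fun_prop

/-- Uniqueness of the fundamental solution. -/
lemma IsFundamentalSolution.unique {α θ β : ℝ} {K L : ℝ≥0 → FiniteMeasure ℝ}
    (hsymb : ∀ κ, (rieszFellerSymbol α θ κ).re ≤ 0)
    (hK : IsFundamentalSolution α θ β K) (hL : IsFundamentalSolution α θ β L) : K = L := by
  have h : ∀ κ, (fun t => charFun (K t : Measure ℝ) κ) = fun t => charFun (L t : Measure ℝ) κ :=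
    fun κ => HasCaputoDeriv.eq_of_eigen (hsymb κ) (continuous_charFun_of_continuous hK.continuous κ)
      (continuous_charFun_of_continuous hL.continuous κ) (by simp only [hK.initial, hL.initial])
      (hK.equation κ) (hL.equation κ)
  funext t
  have e : (K t : Measure ℝ) = L t := Measure.ext_of_charFun (funext fun κ => congrFun (h κ) t)
  exact Subtype.ext e

/-! ### Gaussian mixtures and subordinated laws. -/

/-- The law of `√(2 ξ) N`, with `ξ` of law `H` and `N` an independent standard Gaussian. -/
noncomputable def gaussianMixture (H : ProbabilityMeasure ℝ) : ProbabilityMeasure ℝ :=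
  (H.prod ⟨ProbabilityTheory.gaussianReal 0 1, inferInstance⟩).map
    (f := fun q => Real.sqrt (2 * q.1) * q.2) (by fun_prop)

lemma toMeasure_gaussianMixture (H : ProbabilityMeasure ℝ) :
    (gaussianMixture H : Measure ℝ) = ((H : Measure ℝ).prod
      (ProbabilityTheory.gaussianReal 0 1)).map (fun q => Real.sqrt (2 * q.1) * q.2) := rfl

/-- A pushforward under a continuous map is weakly continuous without any study of densities, and it
allows `ξ = 0`, which occurs at time zero. -/
lemma continuous_gaussianMixture : Continuous gaussianMixture :=
  (ProbabilityMeasure.continuous_map (f := fun q : ℝ × ℝ => Real.sqrt (2 * q.1) * q.2)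
    (by fun_prop)).comp
    (ProbabilityMeasure.continuous_prod.comp (continuous_id.prodMk continuous_const))

lemma charFun_gaussianMixture {H : ProbabilityMeasure ℝ} (hH : ∀ᵐ ξ ∂(H : Measure ℝ), 0 ≤ ξ)
    (κ : ℝ) : charFun (gaussianMixture H : Measure ℝ) κ
      = ((∫ ξ, Real.exp (-(κ ^ 2 * ξ)) ∂(H : Measure ℝ) : ℝ) : ℂ) := by
  rw [toMeasure_gaussianMixture, charFun_apply_real, integral_map (by fun_prop) (by fun_prop),
    integral_prod, ← integral_complex_ofReal]
  · refine integral_congr_ae ?_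
    filter_upwards [hH] with ξ hξ
    have h := ProbabilityTheory.charFun_gaussianReal (μ := 0) (v := 1) (Real.sqrt (2 * ξ) * κ)
    rw [charFun_apply_real] at h
    have h2 : Real.sqrt (2 * ξ) ^ 2 = 2 * ξ := Real.sq_sqrt (by positivity)
    calc _ = ∫ x, Complex.exp (((Real.sqrt (2 * ξ) * κ : ℝ) : ℂ) * x * Complex.I)
          ∂(ProbabilityTheory.gaussianReal 0 1) := by
          refine integral_congr_ae (ae_of_all _ fun x => ?_)
          simp only
          congr 1
          push_cast
          ring
      _ = _ := by
          rw [h, Complex.ofReal_exp]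
          congr 1
          have e : -(((1 : ℝ≥0) : ℝ) * (Real.sqrt (2 * ξ) * κ) ^ 2 / 2) = -(κ ^ 2 * ξ) := by
            rw [mul_pow, h2, NNReal.coe_one]; ring
          rw [← e]
          push_cast
          ring
  · refine Integrable.of_bound (Measurable.aestronglyMeasurable (by fun_prop)) 1
      (ae_of_all _ fun q => ?_)
    rw [← Complex.ofReal_mul, Complex.norm_exp_ofReal_mul_I]

section Subordination

variable {σ τ : ProbabilityMeasure ℝ} {β γ : ℝ}

/-- The law of `(t / y) ^ c * x`, with `y` of law `σ` and `x` independent of law `τ`. -/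
noncomputable def subordinatedLaw (σ τ : ProbabilityMeasure ℝ) (c : ℝ) (t : ℝ≥0) : ProbabilityMeasure ℝ :=
  (σ.prod τ).map (f := fun q => ((t : ℝ) / q.1) ^ c * q.2) (by fun_prop)

lemma toMeasure_subordinatedLaw (c : ℝ) (t : ℝ≥0) :
    (subordinatedLaw σ τ c t : Measure ℝ) =
      ((σ : Measure ℝ).prod (τ : Measure ℝ)).map (fun q => ((t : ℝ) / q.1) ^ c * q.2) := rfl

lemma continuous_subordinatedLaw {c : ℝ} (hc : 0 < c) : Continuous (subordinatedLaw σ τ c) := by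
  refine continuous_iff_continuousAt.2 fun t₀ =>
    ProbabilityMeasure.tendsto_iff_forall_integral_tendsto.2 fun f => ?_
  have hcont : Continuous fun t : ℝ≥0 => ∫ q : ℝ × ℝ, f (((t : ℝ) / q.1) ^ c * q.2)
      ∂((σ : Measure ℝ).prod (τ : Measure ℝ)) := by
    refine continuous_of_dominated (bound := fun _ => ‖f‖)
      (fun t => Measurable.aestronglyMeasurable
        (f.continuous.measurable.comp (by fun_prop)))
      (fun t => ae_of_all _ fun q => f.norm_coe_le_norm _) (integrable_const _)
      (ae_of_all _ fun q => f.continuous.comp ?_)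
    exact ((NNReal.continuous_coe.div_const _).rpow_const fun _ => Or.inr hc.le).mul_const _
  have h : ∀ t : ℝ≥0, ∫ x, f x ∂(subordinatedLaw σ τ c t : Measure ℝ)
      = ∫ q : ℝ × ℝ, f (((t : ℝ) / q.1) ^ c * q.2)
        ∂((σ : Measure ℝ).prod (τ : Measure ℝ)) := fun t => by
    rw [toMeasure_subordinatedLaw]
    exact integral_map (by fun_prop) f.continuous.aestronglyMeasurable
  simp only [h]
  exact hcont.tendsto t₀

lemma subordinatedLaw_zero {c : ℝ} (hc : 0 < c) :
    (subordinatedLaw σ τ c 0 : Measure ℝ) = Measure.dirac 0 := by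
  rw [toMeasure_subordinatedLaw]
  simp [Real.zero_rpow hc.ne', Measure.map_const]

lemma ae_subordinatedLaw {c : ℝ} (hσ : ∀ᵐ y ∂(σ : Measure ℝ), 0 < y)
    (hτ : ∀ᵐ x ∂(τ : Measure ℝ), 0 < x) {t : ℝ≥0} (ht : 0 < t) :
    ∀ᵐ ξ ∂(subordinatedLaw σ τ c t : Measure ℝ), 0 < ξ := by
  rw [toMeasure_subordinatedLaw, ae_map_iff (by fun_prop) measurableSet_Ioi]
  filter_upwards [Measure.quasiMeasurePreserving_fst.ae hσ,
    Measure.quasiMeasurePreserving_snd.ae hτ] with q h1 h2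
  have : (0 : ℝ) < t := ht
  positivity

lemma ae_nonneg_subordinatedLaw {c : ℝ} (hσ : ∀ᵐ y ∂(σ : Measure ℝ), 0 < y)
    (hτ : ∀ᵐ x ∂(τ : Measure ℝ), 0 < x) (t : ℝ≥0) :
    ∀ᵐ ξ ∂(subordinatedLaw σ τ c t : Measure ℝ), 0 ≤ ξ := by
  rw [toMeasure_subordinatedLaw, ae_map_iff (by fun_prop) measurableSet_Ici]
  filter_upwards [Measure.quasiMeasurePreserving_fst.ae hσ,
    Measure.quasiMeasurePreserving_snd.ae hτ] with q h1 h2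
  positivity

/-- Condition on `y`: the symbol is homogeneous of degree `γ`, so the scale `(t / y) ^ (β / γ)`
comes out as the factor `(t / y) ^ β`. -/
lemma charFun_subordinatedLaw (hγ : 0 < γ) (hσ : ∀ᵐ y ∂(σ : Measure ℝ), 0 < y)
    (hτ : ∀ᵐ x ∂(τ : Measure ℝ), 0 < x)
    (hτL : ∀ s : ℝ, 0 < s → ∫ x, Real.exp (-(s * x)) ∂(τ : Measure ℝ) = Real.exp (-s ^ γ))
    (t : ℝ≥0) (κ : ℝ) :
    charFun (subordinatedLaw σ τ (β / γ) t : Measure ℝ) κ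
      = ∫ y, Complex.exp (rieszFellerSymbol γ (-γ) κ * ((((t : ℝ) / y) ^ β : ℝ) : ℂ))
          ∂(σ : Measure ℝ) := by
  rw [toMeasure_subordinatedLaw, charFun_apply_real, integral_map (by fun_prop) (by fun_prop),
    integral_prod]
  · refine integral_congr_ae ?_
    filter_upwards [hσ] with y hy
    have hty : 0 ≤ (t : ℝ) / y := div_nonneg t.2 hy.le
    have h := charFun_stable hγ hτ hτL (((t : ℝ) / y) ^ (β / γ) * κ)
    rw [rieszFellerSymbol_const_mul hγ (Real.rpow_nonneg hty _), ← Real.rpow_mul hty,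
      div_mul_cancel₀ _ hγ.ne', mul_comm ((_ : ℝ) : ℂ) (rieszFellerSymbol _ _ _)] at h
    rw [← h, charFun_apply_real]
    refine integral_congr_ae (ae_of_all _ fun x => ?_)
    simp only
    congr 1
    push_cast
    ring
  · refine Integrable.of_bound (Measurable.aestronglyMeasurable (by fun_prop)) 1
      (ae_of_all _ fun q => ?_)
    rw [← Complex.ofReal_mul, Complex.norm_exp_ofReal_mul_I]

/-- The heart of subordination: the Gaussian evaluates the Laplace transform of the one-sided law at
`κ²`, and `(κ²) ^ γ = |κ| ^ (2 γ)`. -/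
lemma charFun_gaussianMixture_subordinatedLaw (hγ : 0 < γ)
    (hσ : ∀ᵐ y ∂(σ : Measure ℝ), 0 < y) (hτ : ∀ᵐ x ∂(τ : Measure ℝ), 0 < x)
    (hτL : ∀ s : ℝ, 0 < s → ∫ x, Real.exp (-(s * x)) ∂(τ : Measure ℝ) = Real.exp (-s ^ γ))
    (t : ℝ≥0) (κ : ℝ) :
    charFun (gaussianMixture (subordinatedLaw σ τ (β / γ) t) : Measure ℝ) κ
      = ∫ y, Complex.exp (rieszFellerSymbol (2 * γ) 0 κ * ((((t : ℝ) / y) ^ β : ℝ) : ℂ))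
          ∂(σ : Measure ℝ) := by
  have hτL' : ∀ s : ℝ, 0 ≤ s → ∫ x, Real.exp (-(s * x)) ∂(τ : Measure ℝ) = Real.exp (-s ^ γ) := by
    intro s hs
    rcases hs.eq_or_lt with rfl | hs
    · simp [Real.zero_rpow hγ.ne']
    · exact hτL s hs
  rw [charFun_gaussianMixture (ae_nonneg_subordinatedLaw hσ hτ t), toMeasure_subordinatedLaw,
    integral_map (by fun_prop) (by fun_prop), integral_prod, ← integral_complex_ofReal]
  · refine integral_congr_ae ?_
    filter_upwards [hσ] with y hy
    have hty : 0 ≤ (t : ℝ) / y := div_nonneg t.2 hy.le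
    have h := hτL' (κ ^ 2 * ((t : ℝ) / y) ^ (β / γ)) (by positivity)
    rw [Real.mul_rpow (by positivity) (by positivity), ← Real.rpow_mul hty,
      div_mul_cancel₀ _ hγ.ne', ← sq_abs, ← Real.rpow_natCast, ← Real.rpow_mul (abs_nonneg κ)] at h
    rw [rieszFellerSymbol_zero_theta, ← Complex.ofReal_mul, ← Complex.ofReal_exp, neg_mul]
    congr 1
    simp only [Nat.cast_ofNat] at h
    rw [← h]
    refine integral_congr_ae (ae_of_all _ fun x => ?_)
    simp only
    rw [Real.rpow_ofNat, sq_abs, mul_assoc]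
  · refine Integrable.of_bound (Measurable.aestronglyMeasurable (by fun_prop)) 1 ?_
    filter_upwards [Measure.quasiMeasurePreserving_fst.ae hσ,
      Measure.quasiMeasurePreserving_snd.ae hτ] with q h1 h2
    rw [Real.norm_of_nonneg (Real.exp_pos _).le, Real.exp_le_one_iff, neg_nonpos]
    positivity

lemma isFundamentalSolution_of_charFun {α θ : ℝ} {K : ℝ≥0 → ProbabilityMeasure ℝ} (hβ : 0 < β)
    (hσ : ∀ᵐ y ∂(σ : Measure ℝ), 0 < y)
    (hσL : ∀ s : ℝ, 0 < s → ∫ x, Real.exp (-(s * x)) ∂(σ : Measure ℝ) = Real.exp (-s ^ β))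
    (hsymb : ∀ κ, (rieszFellerSymbol α θ κ).re ≤ 0) (hK : Continuous K)
    (hK0 : (K 0 : Measure ℝ) = Measure.dirac 0)
    (h : ∀ t κ, charFun (K t : Measure ℝ) κ
      = ∫ y, Complex.exp (rieszFellerSymbol α θ κ * ((((t : ℝ) / y) ^ β : ℝ) : ℂ))
          ∂(σ : Measure ℝ)) :
    IsFundamentalSolution α θ β (fun t => (K t).toFiniteMeasure) where
  continuous := ProbabilityMeasure.toFiniteMeasure_continuous.comp hK
  initial := hK0
  equation κ := by
    have e : ∀ t, charFun ((K t).toFiniteMeasure : Measure ℝ) κ = _ := fun t => h t κ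
    simp only [e]
    exact hasCaputoDeriv_mittagLeffler hβ hσ hσL (hsymb κ)

end Subordination

/-! ### Regularity of the mixture density. -/

lemma heatKernel_eq_gaussianPDFReal {ξ : ℝ} (hξ : 0 < ξ) (x : ℝ) :
    heatKernel x ξ = ProbabilityTheory.gaussianPDFReal 0 (2 * ξ).toNNReal x := by
  rw [heatKernel, ProbabilityTheory.gaussianPDFReal, Real.coe_toNNReal _ (by positivity),
    div_eq_inv_mul, sub_zero]
  ring_nf

/-- With `z = |x| / √(4 π ξ)` the claim is `z ≤ exp (π z²)`, which follows from `z ≤ 1 + π z²`. -/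
lemma heatKernel_le_inv_abs {x ξ : ℝ} (hx : x ≠ 0) (hξ : 0 < ξ) : heatKernel x ξ ≤ |x|⁻¹ := by
  have hr : 0 < Real.sqrt (4 * Real.pi * ξ) := Real.sqrt_pos.2 (by positivity)
  have hr2 : Real.sqrt (4 * Real.pi * ξ) ^ 2 = 4 * Real.pi * ξ := Real.sq_sqrt (by positivity)
  have hx' : 0 < |x| := abs_pos.2 hx
  rw [heatKernel, div_le_iff₀ hr, inv_mul_eq_div, le_div_iff₀ hx', neg_div, Real.exp_neg,
    inv_mul_le_iff₀ (Real.exp_pos _)]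
  set r := Real.sqrt (4 * Real.pi * ξ)
  have e : x ^ 2 / (4 * ξ) = Real.pi * (|x| / r) ^ 2 := by
    rw [div_pow, hr2, sq_abs]
    field_simp
  have h1 : |x| / r ≤ Real.exp (x ^ 2 / (4 * ξ)) := by
    rw [e]
    refine le_trans ?_ (Real.add_one_le_exp _)
    nlinarith [Real.pi_gt_three, sq_nonneg (|x| / r), sq_nonneg (|x| / r - 1)]
  rwa [div_le_iff₀ hr] at h1

lemma heatKernel_le_zero_left (x : ℝ) {ξ : ℝ} (hξ : 0 < ξ) : heatKernel x ξ ≤ heatKernel 0 ξ := by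
  unfold heatKernel
  refine div_le_div_of_nonneg_right (Real.exp_le_exp.2 ?_) (Real.sqrt_nonneg _)
  refine div_le_div_of_nonneg_right ?_ (by positivity)
  nlinarith [sq_nonneg x]

lemma continuous_heatKernel_left (ξ : ℝ) : Continuous fun x => heatKernel x ξ := by
  unfold heatKernel
  fun_prop

lemma measurable_heatKernel : Measurable fun q : ℝ × ℝ => heatKernel q.1 q.2 := by
  unfold heatKernel
  fun_prop

section Mixture

variable (H : Measure ℝ) [IsProbabilityMeasure H]

/-- The density of the mixture of Gaussian laws of variance `2 ξ`, for `ξ` of law `H`. -/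
noncomputable def mixtureDensity (x : ℝ) : ℝ≥0∞ :=
  ∫⁻ ξ in Ioi (0 : ℝ), ENNReal.ofReal (heatKernel x ξ) ∂H

lemma measurable_ofReal_heatKernel (x : ℝ) : Measurable fun ξ => ENNReal.ofReal (heatKernel x ξ) :=
  (measurable_heatKernel.comp measurable_prodMk_left).ennreal_ofReal

lemma mixtureDensity_le {x : ℝ} (hx : x ≠ 0) : mixtureDensity H x ≤ ENNReal.ofReal |x|⁻¹ := by
  calc mixtureDensity H x ≤ ∫⁻ _ in Ioi (0 : ℝ), ENNReal.ofReal |x|⁻¹ ∂H :=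
        setLIntegral_mono measurable_const fun ξ hξ =>
          ENNReal.ofReal_le_ofReal (heatKernel_le_inv_abs hx hξ)
    _ ≤ ENNReal.ofReal |x|⁻¹ := by
        rw [setLIntegral_const]
        exact mul_le_of_le_one_right zero_le prob_le_one

lemma continuous_mixtureDensity : Continuous (mixtureDensity H) := by
  have hlim : ∀ x ξ : ℝ, Tendsto (fun y => ENNReal.ofReal (heatKernel y ξ)) (𝓝 x)
      (𝓝 (ENNReal.ofReal (heatKernel x ξ))) := fun x ξ =>
    (ENNReal.continuous_ofReal.comp (continuous_heatKernel_left ξ)).tendsto x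
  rw [continuous_iff_continuousAt]
  intro x
  rcases eq_or_ne x 0 with rfl | hx
  -- At 0 the density may be infinite and domination fails: Fatou gives the lower bound, and the
  -- kernel being largest at `x = 0` gives the upper one.
  · refine tendsto_of_seq_tendsto fun u hu => ?_
    refine tendsto_of_le_liminf_of_limsup_le ?_ ?_
    · calc mixtureDensity H 0
          = ∫⁻ ξ in Ioi (0 : ℝ),
              liminf (fun n => ENNReal.ofReal (heatKernel (u n) ξ)) atTop ∂H :=
            lintegral_congr fun ξ => ((hlim 0 ξ).comp hu).liminf_eq.symm
        _ ≤ _ := lintegral_liminf_le fun n => measurable_ofReal_heatKernel (u n)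
    · refine limsup_le_of_le (h := .of_forall fun n => ?_)
      exact setLIntegral_mono (measurable_ofReal_heatKernel 0) fun ξ hξ =>
        ENNReal.ofReal_le_ofReal (heatKernel_le_zero_left (u n) hξ)
  · have hx' : 0 < |x| := abs_pos.2 hx
    refine tendsto_lintegral_filter_of_dominated_convergence
      (fun _ => ENNReal.ofReal (|x| / 2)⁻¹)
      (.of_forall fun y => measurable_ofReal_heatKernel y) ?_ (by
        rw [setLIntegral_const]
        exact ENNReal.mul_ne_top ENNReal.ofReal_ne_top (measure_ne_top _ _))
      (ae_of_all _ fun ξ => hlim x ξ)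
    have hev : ∀ᶠ y in 𝓝 x, |x| / 2 < |y| :=
      continuous_abs.continuousAt.eventually (lt_mem_nhds (by linarith))
    filter_upwards [hev] with y hy
    refine ae_restrict_of_forall_mem measurableSet_Ioi fun ξ hξ => ?_
    have hy0 : 0 < |y| := by linarith
    exact ENNReal.ofReal_le_ofReal ((heatKernel_le_inv_abs (abs_pos.1 hy0) hξ).trans
      (inv_anti₀ (by positivity) hy.le))

lemma tendsto_mixtureDensity_cocompact : Tendsto (mixtureDensity H) (cocompact ℝ) (𝓝 0) := by
  have h1 : Tendsto (fun x : ℝ => ENNReal.ofReal |x|⁻¹) (cocompact ℝ) (𝓝 0) := by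
    have := (ENNReal.continuous_ofReal.tendsto 0).comp
      (tendsto_inv_atTop_zero.comp (tendsto_norm_cocompact_atTop (E := ℝ)))
    simpa [Function.comp_def] using this
  refine tendsto_of_tendsto_of_tendsto_of_le_of_le' tendsto_const_nhds h1
    (.of_forall fun _ => zero_le) ?_
  have : ∀ᶠ x : ℝ in cocompact ℝ, x ≠ 0 := by
    simpa using (isCompact_singleton (x := (0 : ℝ))).compl_mem_cocompact
  filter_upwards [this] with x hx
  exact mixtureDensity_le H hx

end Mixture

/-- Tonelli, with `√(2 ξ) N` of variance `2 ξ`. Strict positivity of `ξ` is essential, as `ξ = 0`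
would contribute a Dirac mass. -/
lemma gaussianMixture_eq_withDensity {H : ProbabilityMeasure ℝ}
    (hH : ∀ᵐ ξ ∂(H : Measure ℝ), 0 < ξ) :
    (gaussianMixture H : Measure ℝ) = volume.withDensity (mixtureDensity (H : Measure ℝ)) := by
  have hm : Measurable fun q : ℝ × ℝ => Real.sqrt (2 * q.1) * q.2 := by fun_prop
  ext A hA
  rw [toMeasure_gaussianMixture, Measure.map_apply hm hA, Measure.prod_apply (hm hA),
    withDensity_apply _ hA]
  unfold mixtureDensity
  rw [lintegral_lintegral_swap (measurable_heatKernel.ennreal_ofReal.aemeasurable),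
    ← setLIntegral_univ, ← setLIntegral_congr (eventuallyEq_univ.2 (show Ioi 0 ∈ ae (H : Measure ℝ) from hH))]
  refine setLIntegral_congr_fun measurableSet_Ioi fun ξ hξ => ?_
  have hξ' : (0 : ℝ) < ξ := hξ
  have hv : (2 * ξ).toNNReal ≠ 0 := (Real.toNNReal_pos.2 (by positivity)).ne'
  have h1 : (ProbabilityTheory.gaussianReal 0 1).map (Real.sqrt (2 * ξ) * ·)
      = ProbabilityTheory.gaussianReal 0 (2 * ξ).toNNReal := by
    rw [ProbabilityTheory.gaussianReal_map_const_mul]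
    congr 1
    · simp
    · ext
      have := Real.sq_sqrt (x := 2 * ξ) (by positivity)
      simpa [hξ'.le] using this
  have h2 := Measure.map_apply (μ := ProbabilityTheory.gaussianReal 0 1)
    (f := (Real.sqrt (2 * ξ) * ·)) (by fun_prop) hA
  rw [h1, ProbabilityTheory.gaussianReal_apply _ hv] at h2
  refine Eq.trans h2.symm (lintegral_congr fun x => ?_)
  rw [heatKernel_eq_gaussianPDFReal hξ', ProbabilityTheory.gaussianPDF]

lemma isContinuousDensity_gaussianMixture {H : ProbabilityMeasure ℝ}
    (hH : ∀ᵐ ξ ∂(H : Measure ℝ), 0 < ξ) :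
    IsContinuousDensity (gaussianMixture H : Measure ℝ) (mixtureDensity (H : Measure ℝ)) where
  continuous := continuous_mixtureDensity _
  finite x hx := (mixtureDensity_le _ hx).trans_lt ENNReal.ofReal_lt_top
  vanishing := tendsto_mixtureDensity_cocompact _
  integral_eq_one := by
    have h : (gaussianMixture H : Measure ℝ) univ = 1 := measure_univ
    rwa [gaussianMixture_eq_withDensity hH, withDensity_apply _ MeasurableSet.univ,
      Measure.restrict_univ] at h
  eq_withDensity := gaussianMixture_eq_withDensity hH

/-! ### Existence, uniqueness and the mixture formula. -/

theorem mainTheorem2 (α β : ℝ) (hα : 0 < α) (hα' : α ≤ 2) (hβ : 0 < β) (hβ' : β ≤ 1) :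
    (∃! K : ℝ≥0 → FiniteMeasure ℝ, IsFundamentalSolution α 0 β K) ∧
    (∃! H : ℝ≥0 → FiniteMeasure ℝ, IsFundamentalSolution (α / 2) (-(α / 2)) β H) ∧
    ∀ K H : ℝ≥0 → FiniteMeasure ℝ,
      IsFundamentalSolution α 0 β K →
      IsFundamentalSolution (α / 2) (-(α / 2)) β H →
      ∀ t : ℝ≥0, 0 < t →
        IsContinuousDensity (K t : Measure ℝ)
          (fun x => ∫⁻ ξ in Ioi (0 : ℝ), ENNReal.ofReal (heatKernel x ξ) ∂(H t : Measure ℝ)) ∧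
        ∀ h : ℝ → ℝ≥0∞, Measurable h → (H t : Measure ℝ) = volume.withDensity h →
          IsContinuousDensity (K t : Measure ℝ)
            (fun x => ∫⁻ ξ in Ioi (0 : ℝ), ENNReal.ofReal (heatKernel x ξ) * h ξ) := by
  have hγ : 0 < α / 2 := by positivity
  have hγ' : α / 2 ≤ 1 := by linarith
  obtain ⟨σ, hσp, hσ, hσL⟩ := exists_stable_measure hβ hβ'
  obtain ⟨τ, hτp, hτ, hτL⟩ := exists_stable_measure hγ hγ'
  have hc : 0 < β / (α / 2) := by positivity
  let H₀ : ℝ≥0 → ProbabilityMeasure ℝ := subordinatedLaw ⟨σ, hσp⟩ ⟨τ, hτp⟩ (β / (α / 2))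
  let K₀ : ℝ≥0 → ProbabilityMeasure ℝ := fun t => gaussianMixture (H₀ t)
  have hsK : ∀ κ, (rieszFellerSymbol α 0 κ).re ≤ 0 := fun κ => by
    rw [rieszFellerSymbol_zero_theta, Complex.ofReal_re, neg_nonpos]
    positivity
  have hsH := re_rieszFellerSymbol_nonpos hγ hγ'
  have hH₀c : Continuous H₀ := continuous_subordinatedLaw hc
  have hH₀0 : (H₀ 0 : Measure ℝ) = Measure.dirac 0 := subordinatedLaw_zero hc
  have hH₀ : IsFundamentalSolution (α / 2) (-(α / 2)) β fun t => (H₀ t).toFiniteMeasure :=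
    isFundamentalSolution_of_charFun (σ := ⟨σ, hσp⟩) hβ hσ hσL hsH hH₀c hH₀0
      (charFun_subordinatedLaw hγ hσ hτ hτL)
  have hK₀ : IsFundamentalSolution α 0 β fun t => (K₀ t).toFiniteMeasure := by
    refine isFundamentalSolution_of_charFun (σ := ⟨σ, hσp⟩) hβ hσ hσL hsK
      (continuous_gaussianMixture.comp hH₀c) ?_ fun t κ => ?_
    · simp only [K₀]
      rw [toMeasure_gaussianMixture, hH₀0, Measure.dirac_prod,
        Measure.map_map (by fun_prop) (by fun_prop)]
      simp [Function.comp_def, Measure.map_const]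
    · have := charFun_gaussianMixture_subordinatedLaw (σ := ⟨σ, hσp⟩) (τ := ⟨τ, hτp⟩) (β := β)
        hγ hσ hτ hτL t κ
      rwa [mul_div_cancel₀ α two_ne_zero] at this
  refine ⟨⟨_, hK₀, fun K hK => hK.unique hsK hK₀⟩, ⟨_, hH₀, fun H hH => hH.unique hsH hH₀⟩,
    fun K H hK hH t ht => ?_⟩
  -- By uniqueness, only the constructed pair needs to be considered.
  obtain rfl := hK.unique hsK hK₀
  obtain rfl := hH.unique hsH hH₀
  have hd := isContinuousDensity_gaussianMixture (H := H₀ t)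
    (ae_subordinatedLaw (σ := ⟨σ, hσp⟩) (τ := ⟨τ, hτp⟩) hσ hτ ht)
  refine ⟨hd, fun h hh hHh => ?_⟩
  have e : mixtureDensity (H₀ t : Measure ℝ)
      = fun x => ∫⁻ ξ in Ioi (0 : ℝ), ENNReal.ofReal (heatKernel x ξ) * h ξ := by
    funext x
    have hHh' : (H₀ t : Measure ℝ) = volume.withDensity h := hHh
    rw [mixtureDensity, hHh', restrict_withDensity measurableSet_Ioi,
      lintegral_withDensity_eq_lintegral_mul _ hh (measurable_ofReal_heatKernel x)]
    exact lintegral_congr fun ξ => mul_comm _ _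
  rw [← e]
  exact hd
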